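/- **Setting.** Let $G$ be a three-dimensional unimodular real Lie group with Lie algebra $\mathfrak g$, and let $U\subset\mathfrak g$ be non-empty, convex and closed with $0\notin U$ and $\lambda U\subset U$ for all $\lambda\ge 1$ (a left-invariant sub-Lorentzian structure). Assume that $\Delta=\operatorname{span}U$ has dimension $2$ and $[\Delta,\Delta]\not\subset\Delta$. Call a basis $f_1,f_2$ of $\Delta$ adapted, with constants $a,b\in\{0,\pm1\}$, $a+b\ge 0$, if $f_3:=[f_1,f_2]\notin\Delta$, $[f_3,f_1]=af_2$ and $[f_3,f_2]=bf_1$. Given such a basis put $\Omega=\{(u_1,u_2)\in\mathbb R^2: u_1f_1+u_2f_2\in U\}$, $C=\overline{\mathbb R_+\Omega}$, and let $\nu$ be the anti-norm with unit ball $\Omega$, i.e. the upper semicontinuous closure of $u\mapsto\sup\{\lambda>0: u\in\lambda\Omega\}$ (with $\sup\varnothing=-\infty$). Assume $(*)$ $\lambda\Omega\cap\partial\Omega=\varnothing$ for all $\lambda>1$, and $(**)$ $\partial C$ is the union of two rays $l_0,l_1$ with $\operatorname{dist}(l_0,\Omega)=\operatorname{dist}(l_1,\Omega)=0$. Let $\Omega^\diamond=\{(p,q):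 px-qy\ge 1\ \ \forall (x,y)\in\Omega\}$. Fix $\omega_0\in\partial\Omega$ and $\omega_0^\diamond=(p_0,q_0)\in\partial\Omega^\diamond$ with $p_0x_0-q_0y_0=1$, where $\omega_0=(x_0,y_0)$. Let $(\cosh_\Omega\theta,\sinh_\Omega\theta)$ be the point $\omega\in\partial\Omega$ for which $\theta$ is twice the signed area bounded by the segments $O\omega_0$, $O\omega$ and the arc of $\partial\Omega$ between $\omega_0$ and $\omega$; define $\cosh_{\Omega^\diamond},\sinh_{\Omega^\diamond}$ in the same way from $\Omega^\diamond$ and $\omega_0^\diamond$. For an angle $\eta$ of $\Omega^\diamond$ let ${}^\diamond\eta$ be the set of angles $\theta$ of $\Omega$ with $\cosh_\Omega\theta\cosh_{\Omega^\diamond}\eta-\sinh_\Omega\theta\sinh_{\Omega^\diamond}\eta=1$. An extremal on $[0,T]$, $T>0$, consists of $\lambda_0\in\{0,-1\}$, Lipschitz curves $q(t)\in G$ and $p(t)\in T^*_{q(t)}G$ and a control $u(t)\in\mathbb R^2$ satisfying the Pontryagin maximum principle for maximizing $\int_0^T\nu(u)\,dt$. That is, $(\lambda_0,p(t))\ne 0$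 for all $t$; $\dot q=dL_q(u_1f_1+u_2f_2)$ a.e.; with $h_x=\langle p,dL_q x\rangle$ one has $\dot h_x=h_{[u_1f_1+u_2f_2,\,x]}$ a.e. for every $x\in\mathfrak g$; and, with $h_k=h_{f_k}$, for a.e. $t$ the function $\mathcal H(v)=h_1v_1+h_2v_2-\lambda_0\nu(v)$ attains its maximum over $v\in C$ at $u(t)\in C$. Extremals are parametrized so that $u(t)\neq0$ for a.e. $t$. An extremal is normal if $\lambda_0=-1$ and abnormal if $\lambda_0=0$; it is timelike if $\nu(u)>0$ a.e. and lightlike if $\nu(u)=0$ a.e. **Theorem.** An adapted basis exists, and for every adapted basis (with $\Omega$ as above satisfying $(*)$ and $(**)$) and every extremal the following holds. 1. The extremal is either normal and timelike, or abnormal and lightlike. 2. For every $t\in[0,T]$, $\max_{v\in C}\mathcal H(v)=0$ and $\sup_{v\in\Omega}\mathcal H(v)=0$; the latter supremum is attained if $\lambda_0=-1$. 3. If the extremal is lightlike, then $u(t)\in\partial C$ for a.e. $t$. 4. If the extremal is timelike, there are a constant $E\in\mathbb R$ and functions $\eta(t),\theta(t)$ such that for all $t\in[0,T]$ $$h_1=-\cosh_{\Omega^\diamond}\eta,\qquad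 h_2=\sinh_{\Omega^\diamond}\eta,\qquad h_3=\pm\sqrt{E-a(\sinh_{\Omega^\diamond}\eta)^2+b(\cosh_{\Omega^\diamond}\eta)^2},$$ $$E\ \ge\ a(\sinh_{\Omega^\diamond}\eta)^2-b(\cosh_{\Omega^\diamond}\eta)^2,$$ and for a.e. $t$ one has $\theta\in{}^\diamond\eta$ and $u=\nu(u)\,(\cosh_\Omega\theta,\sinh_\Omega\theta)$. With the natural parametrization ($\nu(u)=1$ a.e.) this reads $u=(\cosh_\Omega\theta,\sinh_\Omega\theta)$, and if moreover the inequality for $E$ is strict on an interval $(\alpha,\beta)\subset[0,T]$, then there is a sign $\sigma\in\{1,-1\}$ such that on $(\alpha,\beta)$ one has $h_3=\sigma\sqrt{E-a(\sinh_{\Omega^\diamond}\eta)^2+b(\cosh_{\Omega^\diamond}\eta)^2}$ and, for all $t_1,t_2\in(\alpha,\beta)$, $$t_2-t_1=\sigma\int_{\eta(t_1)}^{\eta(t_2)}\frac{d\eta}{\sqrt{E-a(\sinh_{\Omega^\diamond}\eta)^2+b(\cosh_{\Omega^\diamond}\eta)^2}}.$$ 5. If a timelike extremal is singular along an edge $F$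 on a measurable set $\mathbb T\subset[0,T]$ of positive measure, i.e. $F$ has at least two points and $\operatorname{argmax}_{v\in\Omega}(h_1v_1+h_2v_2)=F$ for a.e. $t\in\mathbb T$, then (with $E,\eta$ as in 4) $\eta$ is constant a.e. on $\mathbb T$ and the inequality for $E$ is an equality a.e. on $\mathbb T$. -/

import Mathlib

open scoped Manifold Topology
open Set MeasureTheory Filter

namespace SubLorentz

/-! ### Convex hyperbolic trigonometry in the plane -/

/-- Assumption (i): non-empty, convex, closed, not containing the origin, with the ray property.
Stated in any real topological vector space: it is used both for subsets of the plane and for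
the unit ball of a left-invariant sub-Lorentzian structure inside the Lie algebra. -/
structure IsBall {V : Type*} [TopologicalSpace V] [AddCommGroup V] [Module ℝ V]
    (U : Set V) : Prop where
  nonempty : U.Nonempty
  convex : Convex ℝ U
  closed : IsClosed U
  zero_notMem : (0 : V) ∉ U
  ray : ∀ c : ℝ, 1 ≤ c → ∀ x ∈ U, c • x ∈ U

/-- The closed cone `C = cl (ℝ₊ Ω)`. -/
def cone (Ω : Set (ℝ × ℝ)) : Set (ℝ × ℝ) :=
  closure {w | ∃ s : ℝ, 0 ≤ s ∧ ∃ v ∈ Ω, w = s • v}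

/-- The ray `{s d | s ≥ 0}`. -/
def ray (d : ℝ × ℝ) : Set (ℝ × ℝ) := {w | ∃ s : ℝ, 0 ≤ s ∧ w = s • d}

/-- Properties `(*)` and `(**)`: no ray issued from the origin lies on `∂Ω`; the boundary of `C`
consists of two rays, and `Ω` is at distance zero from each of them. -/
structure DualAssumptions (Ω : Set (ℝ × ℝ)) : Prop where
  star : ∀ c : ℝ, 1 < c → ∀ w ∈ Ω, c • w ∉ frontier Ω
  starstar : ∃ d₀ d₁ : ℝ × ℝ, d₀ ≠ 0 ∧ d₁ ≠ 0 ∧ frontier (cone Ω) = ray d₀ ∪ ray d₁ ∧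
    (∀ ε : ℝ, 0 < ε → ∃ x ∈ ray d₀, ∃ y ∈ Ω, dist x y < ε) ∧
    (∀ ε : ℝ, 0 < ε → ∃ x ∈ ray d₁, ∃ y ∈ Ω, dist x y < ε)

/-- `sup {s > 0 | w ∈ s Ω}`, with `sup ∅ = -∞`. -/
noncomputable def preAntiNorm (Ω : Set (ℝ × ℝ)) (w : ℝ × ℝ) : EReal :=
  sSup {c : EReal | ∃ s : ℝ, 0 < s ∧ (∃ v ∈ Ω, w = s • v) ∧ c = (s : EReal)}

/-- The anti-norm `ν_Ω` with unit ball `Ω`: the upper semicontinuous closure of `preAntiNorm Ω`.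
It is finite on `cone Ω` and `-∞` outside it. -/
noncomputable def antiNorm (Ω : Set (ℝ × ℝ)) (w : ℝ × ℝ) : EReal :=
  limsup (preAntiNorm Ω) (𝓝 w)

/-- The pairing `p x - q y` of `(p, q)` with `(x, y)`. -/
def pairing (P w : ℝ × ℝ) : ℝ := P.1 * w.1 - P.2 * w.2

/-- The antipolar set `Ω^◇`. -/
def antipolar (Ω : Set (ℝ × ℝ)) : Set (ℝ × ℝ) := {P | ∀ w ∈ Ω, 1 ≤ pairing P w}

/-- Twice the signed area enclosed by the segment `O w₀`, the arc of `∂Ω` from `w₀` to `w` and the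
segment `w O` (positive when going from `w₀` to `w` counterclockwise). The enclosed
region is the part, outside `Ω`, of the angle with vertex `O` spanned by `w₀` and `w`. -/
noncomputable def sectorAngle (Ω : Set (ℝ × ℝ)) (w₀ w : ℝ × ℝ) : ℝ :=
  Real.sign (w₀.1 * w.2 - w₀.2 * w.1) *
    (2 * (volume ({z : ℝ × ℝ | ∃ r s : ℝ, 0 ≤ r ∧ 0 ≤ s ∧ z = r • w₀ + s • w} \ Ω)).toReal)

/-- The set of admissible angles: the domain of `cosh_Ω` and `sinh_Ω` with base point `w₀`. -/
def angleDomain (Ω : Set (ℝ × ℝ)) (w₀ : ℝ × ℝ) : Set ℝ := sectorAngle Ω w₀ '' frontier Ω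

/-- The point `(cosh_Ω θ, sinh_Ω θ)` of `∂Ω` whose angle, counted from `w₀`, is `θ`
(meaningful for `θ ∈ angleDomain Ω w₀`). -/
noncomputable def trigPoint (Ω : Set (ℝ × ℝ)) (w₀ : ℝ × ℝ) (θ : ℝ) : ℝ × ℝ :=
  Function.invFunOn (sectorAngle Ω w₀) (frontier Ω) θ

/-- `cosh_Ω`, with base point `w₀`. -/
noncomputable def ch (Ω : Set (ℝ × ℝ)) (w₀ : ℝ × ℝ) (θ : ℝ) : ℝ := (trigPoint Ω w₀ θ).1

/-- `sinh_Ω`, with base point `w₀`. -/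
noncomputable def sh (Ω : Set (ℝ × ℝ)) (w₀ : ℝ × ℝ) (θ : ℝ) : ℝ := (trigPoint Ω w₀ θ).2

/-- The set `^◇η` of the angles `θ` of `Ω` corresponding to the angle `η` of `Ω^◇`: the point of
`∂Ω` with angle `θ` lies on the line determined by the point of `∂Ω^◇` with angle `η`. -/
def dualAngles (Ω : Set (ℝ × ℝ)) (w₀ P₀ : ℝ × ℝ) (η : ℝ) : Set ℝ :=
  {θ | θ ∈ angleDomain Ω w₀ ∧ pairing (trigPoint (antipolar Ω) P₀ η) (trigPoint Ω w₀ θ) = 1}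

/-! ### Pontryagin extremals of the left-invariant problem -/

/-- A Lipschitz curve on `[0, T]` in a three-dimensional manifold. -/
def IsLipschitzCurve {G : Type*} [TopologicalSpace G] [ChartedSpace (EuclideanSpace ℝ (Fin 3)) G]
    (q : ℝ → G) (T : ℝ) : Prop :=
  ContinuousOn q (Icc 0 T) ∧
    ∀ t ∈ Icc 0 T, ∃ K : NNReal, ∃ s ∈ 𝓝[Icc 0 T] t,
      LipschitzOnWith K (fun r => extChartAt (𝓡 3) (q t) (q r)) s

/-- The linear Hamiltonian `h_x(g, p) = ⟨p, dL_g x⟩` of `x` in the Lie algebra. -/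
noncomputable def momentum {G : Type*} [TopologicalSpace G]
    [ChartedSpace (EuclideanSpace ℝ (Fin 3)) G] [Group G]
    {g : G} (p : TangentSpace (𝓡 3) g →L[ℝ] ℝ) (x : GroupLieAlgebra (𝓡 3) G) : ℝ :=
  p (mulInvariantVectorField x g)

/-- The Pontryagin function `⟨h, u⟩ - λ₀ ν(u)`, for `u` in the cone `C`. -/
noncomputable def pontryagin (Ω : Set (ℝ × ℝ)) (lam : ℝ) (h u : ℝ × ℝ) : ℝ :=
  h.1 * u.1 + h.2 * u.2 - lam * (antiNorm Ω u).toReal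

/-- The unit ball `U ⊆ span {f₁, f₂}` in the coordinates `(u₁, u₂)` given by `f₁, f₂`. -/
def planeBall {V : Type*} [AddCommGroup V] [Module ℝ V] (U : Set V) (f₁ f₂ : V) :
    Set (ℝ × ℝ) :=
  {w | w.1 • f₁ + w.2 • f₂ ∈ U}

/-- `f₁, f₂` is a basis of `Δ = span U` with `f₃ = [f₁, f₂] ∉ Δ`, `[f₃, f₁] = a f₂`,
`[f₃, f₂] = b f₁`, where `a, b ∈ {0, 1, -1}` and `a + b ≥ 0`. -/
structure IsAdaptedFrame {G : Type*} [TopologicalSpace G]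
    [ChartedSpace (EuclideanSpace ℝ (Fin 3)) G] [Group G]
    (U : Set (GroupLieAlgebra (𝓡 3) G)) (a b : ℝ) (f₁ f₂ : GroupLieAlgebra (𝓡 3) G) : Prop where
  span_eq : Submodule.span ℝ {f₁, f₂} = Submodule.span ℝ U
  f₃_notMem : ⁅f₁, f₂⁆ ∉ Submodule.span ℝ U
  lie_f₁ : ⁅⁅f₁, f₂⁆, f₁⁆ = a • f₂
  lie_f₂ : ⁅⁅f₁, f₂⁆, f₂⁆ = b • f₁
  a_mem : a = 0 ∨ a = 1 ∨ a = -1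
  b_mem : b = 0 ∨ b = 1 ∨ b = -1
  nonneg : 0 ≤ a + b

/-- `(q, p, u)` is a Pontryagin extremal on `[0, T]`, with multiplier `lam = λ₀`, of the problem of
maximizing `∫ ν_Ω(u) dt` over the Lipschitz curves `q` with `q̇ = dL_q (u₁ f₁ + u₂ f₂)`. The
covector `p t` lies in the cotangent space at `q t`. Hamilton's equation for `p` is written in terms
of the linear Hamiltonians `h_x = ⟨p, dL_q x⟩`, for which `{h_x, h_y} = h_[x, y]`. -/
structure IsExtremal {G : Type*} [TopologicalSpace G]
    [ChartedSpace (EuclideanSpace ℝ (Fin 3)) G] [Group G]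
    (f₁ f₂ : GroupLieAlgebra (𝓡 3) G) (Ω : Set (ℝ × ℝ)) (T lam : ℝ) (q : ℝ → G)
    (p : (t : ℝ) → TangentSpace (𝓡 3) (q t) →L[ℝ] ℝ) (u : ℝ → ℝ × ℝ) : Prop where
  T_pos : 0 < T
  lam_mem : lam = 0 ∨ lam = -1
  nontrivial : ∀ t ∈ Icc 0 T, lam ≠ 0 ∨ p t ≠ 0
  q_lipschitz : IsLipschitzCurve q T
  p_lipschitz : ∀ x : GroupLieAlgebra (𝓡 3) G, ∃ K : NNReal,
    LipschitzOnWith K (fun t => momentum (p t) x) (Icc 0 T)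
  q_deriv : ∀ᵐ t ∂(volume.restrict (Icc 0 T)),
    HasMFDerivAt 𝓘(ℝ, ℝ) (𝓡 3) q t ((1 : ℝ →L[ℝ] ℝ).smulRight
      (mulInvariantVectorField ((u t).1 • f₁ + (u t).2 • f₂) (q t)))
  p_deriv : ∀ x : GroupLieAlgebra (𝓡 3) G, ∀ᵐ t ∂(volume.restrict (Icc 0 T)),
    HasDerivAt (fun t => momentum (p t) x)
      (momentum (p t) ⁅(u t).1 • f₁ + (u t).2 • f₂, x⁆) t
  maximum : ∀ᵐ t ∂(volume.restrict (Icc 0 T)), u t ∈ cone Ω ∧ ∀ v ∈ cone Ω,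
    pontryagin Ω lam (momentum (p t) f₁, momentum (p t) f₂) v ≤
      pontryagin Ω lam (momentum (p t) f₁, momentum (p t) f₂) (u t)

/-- Timelike: `ν(u) > 0` almost everywhere. -/
def IsTimelike (Ω : Set (ℝ × ℝ)) (T : ℝ) (u : ℝ → ℝ × ℝ) : Prop :=
  ∀ᵐ t ∂(volume.restrict (Icc 0 T)), 0 < antiNorm Ω (u t)

/-- Lightlike: `ν(u) = 0` almost everywhere. -/
def IsLightlike (Ω : Set (ℝ × ℝ)) (T : ℝ) (u : ℝ → ℝ × ℝ) : Prop :=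
  ∀ᵐ t ∂(volume.restrict (Icc 0 T)), antiNorm Ω (u t) = 0

/-- Natural parametrization: `ν(u) = 1` almost everywhere. -/
def IsNatural (Ω : Set (ℝ × ℝ)) (T : ℝ) (u : ℝ → ℝ × ℝ) : Prop :=
  ∀ᵐ t ∂(volume.restrict (Icc 0 T)), antiNorm Ω (u t) = 1

/-- The extremal with `(h₁, h₂)(t) = h t` is singular along `F`, with `dim F ≥ 1`, on the set `S` of
positive measure: for almost every `t ∈ S` the set of the maximizers of `⟨h t, ·⟩` over `Ω`
is exactly `F`. -/
structure IsSingularOn (Ω : Set (ℝ × ℝ)) (T : ℝ) (h : ℝ → ℝ × ℝ) (F : Set (ℝ × ℝ)) (S : Set ℝ) :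
    Prop where
  nontrivial : F.Nontrivial
  subset : S ⊆ Icc 0 T
  measurable : NullMeasurableSet S volume
  pos : 0 < volume S
  argmax : ∀ᵐ t ∂(volume.restrict S),
    {v | v ∈ Ω ∧ ∀ w ∈ Ω, (h t).1 * w.1 + (h t).2 * w.2 ≤ (h t).1 * v.1 + (h t).2 * v.2} = F

/-- The expression `E - a sinh_{Ω^◇}(η)² + b cosh_{Ω^◇}(η)²`, the base point on `∂Ω^◇`
being `P₀`. -/
noncomputable def radicand (Ω : Set (ℝ × ℝ)) (P₀ : ℝ × ℝ) (a b E η : ℝ) : ℝ :=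
  E - a * sh (antipolar Ω) P₀ η ^ 2 + b * ch (antipolar Ω) P₀ η ^ 2

end SubLorentz

namespace SubLorentz

/-! ### The pairing and antipolar sets -/

/-! Put `P = (-h₁, h₂)`, so that `h₁ v₁ + h₂ v₂ = -pairing P v`. The Pontryagin function is
positively homogeneous in the control, so its maximum over the cone is zero. On the cone the
anti-norm is the infimum of `pairing P ·` over `P` in the antipolar set (`antiNorm_eq_dualGauge`, by
the bipolar theorem), so the maximum condition becomes a statement about supporting lines.

In the normal case it says that `P` runs along the boundary of the antipolar set and that the
rescaled control is a point of `Ω` supporting it at `P`. In the abnormal case `P` is nonnegative on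
the cone and vanishes at `u`. If `u` were interior, `P` would be zero, hence `h₃ ≠ 0`. At almost
every zero of `h₁` and `h₂` their derivatives `-u₂ h₃` and `u₁ h₃` also vanish, which forces `u =
0`. The same argument on level sets of `h₁`, `h₂` gives `h₃ = 0` on singular arcs.

The formulas for timelike extremals rest on two facts. The quantity `h₃² + a h₂² - b h₁²` is
conserved (`first_integral`), and its value is `E`. The angle `η` of `P` has speed `cross P P' = h₃
* pairing P u`, which is `h₃` in the natural parametrization (`hasDerivAt_angle`). Separation of
variables in `η' = ±√(...)` then gives the time integral. The boundary need not be smooth: the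
signed area is additive (`sectorAngle_add`) and agrees with the cross product to first order
(`abs_sectorAngle_sub_cross_le`), so `hasDerivAt_sectorAngle` needs only a supporting line.

An adapted basis exists because unimodularity makes `ad [f₁, f₂]` traceless on `Δ`, and a traceless
2×2 matrix is antidiagonal in a suitable basis (`exists_antidiagonal`). -/

lemma pairing_add_right (P v w : ℝ × ℝ) : pairing P (v + w) = pairing P v + pairing P w := by
  simp only [pairing, Prod.fst_add, Prod.snd_add]; ring

lemma pairing_smul_right (P : ℝ × ℝ) (c : ℝ) (w : ℝ × ℝ) :
    pairing P (c • w) = c * pairing P w := by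
  simp only [pairing, Prod.smul_fst, Prod.smul_snd, smul_eq_mul]; ring

lemma pairing_add_left (P Q w : ℝ × ℝ) : pairing (P + Q) w = pairing P w + pairing Q w := by
  simp only [pairing, Prod.fst_add, Prod.snd_add]; ring

lemma pairing_smul_left (P : ℝ × ℝ) (c : ℝ) (w : ℝ × ℝ) :
    pairing (c • P) w = c * pairing P w := by
  simp only [pairing, Prod.smul_fst, Prod.smul_snd, smul_eq_mul]; ring

lemma continuous_pairing : Continuous fun z : (ℝ × ℝ) × (ℝ × ℝ) => pairing z.1 z.2 := by
  unfold pairing; fun_prop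

lemma continuous_pairing_left (w : ℝ × ℝ) : Continuous fun P => pairing P w := by
  unfold pairing; fun_prop

lemma continuous_pairing_right (P : ℝ × ℝ) : Continuous fun w => pairing P w := by
  unfold pairing; fun_prop

lemma exists_pairing_eq (f : StrongDual ℝ (ℝ × ℝ)) : ∃ Q, ∀ w, pairing Q w = f w := by
  refine ⟨(f (1, 0), -f (0, 1)), fun w => ?_⟩
  have hw : w = w.1 • ((1, 0) : ℝ × ℝ) + w.2 • ((0, 1) : ℝ × ℝ) := by ext <;> simp
  conv_rhs => rw [hw]
  simp only [map_add, map_smul, smul_eq_mul, pairing]; ring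

variable {Ω : Set (ℝ × ℝ)}

lemma isClosed_antipolar (Ω : Set (ℝ × ℝ)) : IsClosed (antipolar Ω) := by
  have : antipolar Ω = ⋂ w ∈ Ω, {P | 1 ≤ pairing P w} := by ext; simp [antipolar]
  rw [this]
  exact isClosed_biInter fun w _ => isClosed_le continuous_const (continuous_pairing_left w)

/-- A closed convex set with the ray property can be strictly separated from a point of its
complement by a functional that is nonnegative on it. -/
lemma IsBall.exists_separating (hΩ : IsBall Ω) {x : ℝ × ℝ} (hx : x ∉ Ω) :
    ∃ (Q : ℝ × ℝ) (u : ℝ), pairing Q x < u ∧ (∀ w ∈ Ω, u < pairing Q w) ∧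
      ∀ w ∈ Ω, 0 ≤ pairing Q w := by
  obtain ⟨f, u, hfx, hfu⟩ := geometric_hahn_banach_point_closed hΩ.convex hΩ.closed hx
  obtain ⟨Q, hQ⟩ := exists_pairing_eq f
  simp only [← hQ] at hfx hfu
  refine ⟨Q, u, hfx, hfu, fun w hw => ?_⟩
  by_contra! hneg
  -- Were `Q` negative at `w`, moving out along the ray through `w` by the factor `u / Q(w)` would
  -- bring the value down to `u` or below.
  have h1 := hfu _ (hΩ.ray (max 1 (u / pairing Q w)) (le_max_left _ _) w hw)
  rw [pairing_smul_right] at h1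
  have h2 : u / pairing Q w ≤ max 1 (u / pairing Q w) := le_max_right _ _
  have h3 := mul_le_mul_of_nonpos_right h2 hneg.le
  rw [div_mul_cancel₀ _ hneg.ne] at h3
  linarith

lemma IsBall.antipolar_nonempty (hΩ : IsBall Ω) : (antipolar Ω).Nonempty := by
  obtain ⟨Q, u, h0, hu, -⟩ := hΩ.exists_separating hΩ.zero_notMem
  have h0' : 0 < u := by simpa [pairing] using h0
  refine ⟨u⁻¹ • Q, fun w hw => ?_⟩
  rw [pairing_smul_left, ← inv_mul_cancel₀ h0'.ne']
  exact mul_le_mul_of_nonneg_left (hu w hw).le (inv_nonneg.2 h0'.le)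

/-- The bipolar theorem. -/
lemma IsBall.mem_of_forall_pairing (hΩ : IsBall Ω) {x : ℝ × ℝ}
    (h : ∀ P ∈ antipolar Ω, 1 ≤ pairing P x) : x ∈ Ω := by
  by_contra hx
  obtain ⟨Q, u, hQx, hu, hQ⟩ := hΩ.exists_separating hx
  rcases lt_or_ge 0 u with hpos | hneg
  · have := h (u⁻¹ • Q) fun w hw => by
      rw [pairing_smul_left, ← inv_mul_cancel₀ hpos.ne']
      exact mul_le_mul_of_nonneg_left (hu w hw).le (inv_nonneg.2 hpos.le)
    rw [pairing_smul_left, inv_mul_eq_div, le_div_iff₀ hpos] at this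
    linarith
  -- Here `Q` is nonnegative on `Ω` and negative at `x`, so it is a recession direction of the
  -- antipolar set. Adding the right multiple of `Q` to `P` makes the pairing with `x` equal to `0 <
  -- 1`.
  · obtain ⟨P, hP⟩ := hΩ.antipolar_nonempty
    have hneg' : pairing Q x < 0 := by linarith
    have key : ∀ n : ℝ, 0 ≤ n → 1 ≤ pairing P x + n * pairing Q x := fun n hn => by
      have := h (P + n • Q) fun w hw => by
        rw [pairing_add_left, pairing_smul_left]
        have := hP w hw
        have := mul_nonneg hn (hQ w hw)
        linarith
      rwa [pairing_add_left, pairing_smul_left] at this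
    have h1 := h P hP
    have h2 := key (pairing P x / -pairing Q x) (div_nonneg (by linarith) (by linarith))
    rw [div_neg, neg_mul, div_mul_cancel₀ _ hneg'.ne] at h2
    linarith

lemma antipolar_isBall (hΩ : IsBall Ω) : IsBall (antipolar Ω) where
  nonempty := hΩ.antipolar_nonempty
  convex := by
    intro P hP Q hQ s r hs hr hsr w hw
    rw [pairing_add_left, pairing_smul_left, pairing_smul_left]
    have h1 := mul_le_mul_of_nonneg_left (hP w hw) hs
    have h2 := mul_le_mul_of_nonneg_left (hQ w hw) hr
    linarith
  closed := isClosed_antipolar Ω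
  zero_notMem h := by
    obtain ⟨w, hw⟩ := hΩ.nonempty
    have := h w hw
    simp [pairing] at this
    linarith
  ray c hc P hP w hw := by
    rw [pairing_smul_left]
    have := hP w hw
    nlinarith

/-! ### The cone generated by the unit ball -/

/-- The cone generated by `Ω`, whose closure is `cone Ω`. -/
def rawCone (Ω : Set (ℝ × ℝ)) : Set (ℝ × ℝ) := {w | ∃ s : ℝ, 0 ≤ s ∧ ∃ v ∈ Ω, w = s • v}

lemma cone_eq_closure (Ω : Set (ℝ × ℝ)) : cone Ω = closure (rawCone Ω) := rfl

lemma subset_rawCone : Ω ⊆ rawCone Ω := fun v hv => ⟨1, zero_le_one, v, hv, (one_smul _ _).symm⟩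

lemma subset_cone : Ω ⊆ cone Ω := subset_rawCone.trans subset_closure

lemma IsBall.convex_rawCone (hΩ : IsBall Ω) : Convex ℝ (rawCone Ω) := by
  rintro _ ⟨s, hs, v, hv, rfl⟩ _ ⟨r, hr, w, hw, rfl⟩ a b ha hb -
  rcases (add_nonneg (mul_nonneg ha hs) (mul_nonneg hb hr)).eq_or_lt with h | h
  · have h1 : a * s = 0 := by nlinarith [mul_nonneg ha hs, mul_nonneg hb hr]
    have h2 : b * r = 0 := by nlinarith [mul_nonneg ha hs, mul_nonneg hb hr]
    exact ⟨0, le_rfl, v, hv, by simp [smul_smul, h1, h2]⟩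
  · refine ⟨a * s + b * r, h.le, _, hΩ.convex hv hw (a := a * s / (a * s + b * r))
      (b := b * r / (a * s + b * r)) (by positivity) (by positivity) (by field_simp), ?_⟩
    simp only [smul_add, smul_smul]
    congr 2 <;> field_simp

lemma isClosed_cone (Ω : Set (ℝ × ℝ)) : IsClosed (cone Ω) := isClosed_closure

lemma IsBall.zero_mem_cone (hΩ : IsBall Ω) : (0 : ℝ × ℝ) ∈ cone Ω := by
  obtain ⟨v, hv⟩ := hΩ.nonempty
  exact subset_closure ⟨0, le_rfl, v, hv, (zero_smul _ _).symm⟩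

lemma smul_mem_cone {c : ℝ} (hc : 0 ≤ c) {w : ℝ × ℝ} (hw : w ∈ cone Ω) : c • w ∈ cone Ω := by
  refine map_mem_closure (continuous_const_smul c) hw ?_
  rintro _ ⟨s, hs, v, hv, rfl⟩
  exact ⟨c * s, mul_nonneg hc hs, v, hv, smul_smul _ _ _⟩

lemma smul_mem_interior_cone {c : ℝ} (hc : 0 < c) {w : ℝ × ℝ} (hw : w ∈ interior (cone Ω)) :
    c • w ∈ interior (cone Ω) := by
  have h := (isOpenMap_smul₀ hc.ne') _ (isOpen_interior (s := cone Ω))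
  refine interior_maximal ?_ h ⟨w, hw, rfl⟩
  rintro _ ⟨z, hz, rfl⟩
  exact smul_mem_cone hc.le (interior_subset hz)

/-- Property `(*)` keeps proper multiples of points of `Ω` off its frontier. This is the source of
the non-empty interior of `Ω` and of its cone. -/
lemma two_smul_mem_interior (hΩ : IsBall Ω) (hD : DualAssumptions Ω) {w : ℝ × ℝ} (hw : w ∈ Ω) :
    (2 : ℝ) • w ∈ interior Ω := by
  have h1 := hD.star 2 one_lt_two w hw
  have h2 := hΩ.ray 2 one_le_two w hw
  by_contra h3
  exact h1 ⟨subset_closure h2, h3⟩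

lemma subset_interior_cone (hΩ : IsBall Ω) (hD : DualAssumptions Ω) : Ω ⊆ interior (cone Ω) := by
  intro w hw
  have := smul_mem_interior_cone (c := 1 / 2) (by norm_num)
    (interior_mono subset_cone (two_smul_mem_interior hΩ hD hw))
  rwa [smul_smul, show (1 / 2 * 2 : ℝ) = 1 by norm_num, one_smul] at this

lemma interior_rawCone_nonempty (hΩ : IsBall Ω) (hD : DualAssumptions Ω) :
    (interior (rawCone Ω)).Nonempty := by
  obtain ⟨w, hw⟩ := hΩ.nonempty
  exact ⟨_, interior_mono subset_rawCone (two_smul_mem_interior hΩ hD hw)⟩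

/-- A convex set with non-empty interior gains no interior points on closure, so interior points of
the cone are genuine multiples of points of `Ω`. -/
lemma interior_cone_subset (hΩ : IsBall Ω) (hD : DualAssumptions Ω) :
    interior (cone Ω) ⊆ rawCone Ω := by
  rw [cone_eq_closure, hΩ.convex_rawCone.interior_closure_eq_interior_of_nonempty_interior
    (interior_rawCone_nonempty hΩ hD)]
  exact interior_subset

lemma pairing_nonneg_of_mem_cone {P w : ℝ × ℝ} (hP : P ∈ antipolar Ω) (hw : w ∈ cone Ω) :
    0 ≤ pairing P w := by
  refine closure_minimal (t := {w | 0 ≤ pairing P w}) ?_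
    (isClosed_le continuous_const (continuous_pairing_right P)) hw
  rintro _ ⟨s, hs, v, hv, rfl⟩
  rw [mem_ofPred_eq, pairing_smul_right]
  exact mul_nonneg hs (zero_le_one.trans (hP v hv))

lemma zero_notMem_interior_cone (hΩ : IsBall Ω) : (0 : ℝ × ℝ) ∉ interior (cone Ω) := by
  intro h
  obtain ⟨P, hP⟩ := hΩ.antipolar_nonempty
  obtain ⟨w, hw⟩ := hΩ.nonempty
  have h1 : ∀ᶠ s : ℝ in 𝓝[>] 0, (-s) • w ∈ cone Ω := by
    have : Tendsto (fun s : ℝ => (-s) • w) (𝓝 0) (𝓝 0) := by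
      have : Continuous fun s : ℝ => (-s) • w := by fun_prop
      simpa using this.tendsto 0
    exact (this.mono_left nhdsWithin_le_nhds).eventually (mem_interior_iff_mem_nhds.1 h)
  obtain ⟨s, hs, hs0⟩ := (h1.and self_mem_nhdsWithin).exists
  have h2 := pairing_nonneg_of_mem_cone hP hs
  rw [pairing_smul_right] at h2
  have := hP w hw
  have : (0 : ℝ) < s := hs0
  nlinarith

lemma exists_pos_smul_of_mem_interior (hΩ : IsBall Ω) (hD : DualAssumptions Ω) {w : ℝ × ℝ}
    (hw : w ∈ interior (cone Ω)) : ∃ s : ℝ, 0 < s ∧ ∃ v ∈ Ω, w = s • v := by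
  obtain ⟨s, hs, v, hv, rfl⟩ := interior_cone_subset hΩ hD hw
  rcases hs.eq_or_lt with rfl | hs
  · rw [zero_smul] at hw
    exact absurd hw (zero_notMem_interior_cone hΩ)
  · exact ⟨s, hs, v, hv, rfl⟩

lemma norm_pairing_le (P w : ℝ × ℝ) : |pairing P w| ≤ 2 * ‖P‖ * ‖w‖ := by
  have h1 : |P.1| ≤ ‖P‖ := norm_fst_le P
  have h2 : |P.2| ≤ ‖P‖ := norm_snd_le P
  have h3 : |w.1| ≤ ‖w‖ := norm_fst_le w
  have h4 : |w.2| ≤ ‖w‖ := norm_snd_le w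
  calc |pairing P w| ≤ |P.1 * w.1| + |P.2 * w.2| := abs_sub _ _
    _ = |P.1| * |w.1| + |P.2| * |w.2| := by rw [abs_mul, abs_mul]
    _ ≤ ‖P‖ * ‖w‖ + ‖P‖ * ‖w‖ := by gcongr
    _ = _ := by ring

/-- A direction of the boundary of the cone is approached by `Ω`. -/
lemma exists_direction (hD : DualAssumptions Ω) {w : ℝ × ℝ} (hw : w ∈ frontier (cone Ω)) :
    ∃ d, d ≠ 0 ∧ d ∈ frontier (cone Ω) ∧ w ∈ ray d ∧
      ∀ ε : ℝ, 0 < ε → ∃ x ∈ ray d, ∃ y ∈ Ω, dist x y < ε := by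
  obtain ⟨d₀, d₁, h0, h1, hf, hd0, hd1⟩ := hD.starstar
  have hmem : ∀ d : ℝ × ℝ, d ∈ ray d := fun d => ⟨1, zero_le_one, (one_smul _ _).symm⟩
  rw [hf] at hw
  rcases hw with hw | hw
  · exact ⟨d₀, h0, hf ▸ Or.inl (hmem _), hw, hd0⟩
  · exact ⟨d₁, h1, hf ▸ Or.inr (hmem _), hw, hd1⟩

/-- Values of a functional on `Ω` compared with its value on an asymptotic direction. -/
lemma exists_pairing_lt {P d : ℝ × ℝ}
    (hd : ∀ ε : ℝ, 0 < ε → ∃ x ∈ ray d, ∃ y ∈ Ω, dist x y < ε) (hP : pairing P d ≤ 0)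
    {δ : ℝ} (hδ : 0 < δ) : ∃ y ∈ Ω, pairing P y < δ := by
  obtain ⟨x, ⟨s, hs, rfl⟩, y, hy, hxy⟩ := hd (δ / (2 * ‖P‖ + 1)) (by positivity)
  refine ⟨y, hy, ?_⟩
  have h1 : pairing P y = s * pairing P d + pairing P (y - s • d) := by
    rw [← pairing_smul_right, ← pairing_add_right, add_sub_cancel]
  have h2 := (le_abs_self _).trans (norm_pairing_le P (y - s • d))
  rw [dist_comm, dist_eq_norm, lt_div_iff₀ (by positivity)] at hxy
  have h3 := mul_nonneg hs (neg_nonneg.2 hP)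
  nlinarith [norm_nonneg (y - s • d)]

/-- On the frontier of the cone strictness comes from `(**)`: a functional nonpositive on a boundary
direction would take values below `1` at the points of `Ω` that approach this ray. -/
lemma pairing_pos_of_mem_cone (hΩ : IsBall Ω) (hD : DualAssumptions Ω) {P w : ℝ × ℝ}
    (hP : P ∈ antipolar Ω) (hw : w ∈ cone Ω) (hw0 : w ≠ 0) : 0 < pairing P w := by
  by_cases hi : w ∈ interior (cone Ω)
  · obtain ⟨s, hs, v, hv, rfl⟩ := exists_pos_smul_of_mem_interior hΩ hD hi
    rw [pairing_smul_right]
    exact mul_pos hs (zero_lt_one.trans_le (hP v hv))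
  · obtain ⟨d, -, -, ⟨s, hs, rfl⟩, hd⟩ := exists_direction hD ⟨subset_closure hw, hi⟩
    have hs' : 0 < s := hs.lt_of_ne fun h => hw0 (by rw [← h, zero_smul])
    rw [pairing_smul_right]
    refine mul_pos hs' ?_
    by_contra! hneg
    obtain ⟨y, hy, hlt⟩ := exists_pairing_lt hd hneg one_pos
    exact (hP y hy).not_gt hlt

/-- A boundary point of the antipolar set supports `Ω`. -/
lemma exists_pairing_eq_one (hΩ : IsBall Ω) (hD : DualAssumptions Ω) {P : ℝ × ℝ}
    (hP : P ∈ frontier (antipolar Ω)) : ∃ w ∈ Ω, pairing P w = 1 := by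
  have hPm : P ∈ antipolar Ω := (isClosed_antipolar Ω).frontier_subset hP
  by_contra! hne
  have hgt : ∀ w ∈ Ω, 1 < pairing P w := fun w hw => (hPm w hw).lt_of_ne (hne w hw).symm
  have hS : IsCompact (cone Ω ∩ Metric.sphere 0 1) :=
    (isCompact_sphere 0 1).inter_left (isClosed_cone Ω)
  -- If the value `1` were not attained, `P` would be interior. The bound `m` on unit vectors of the
  -- cone persists for nearby functionals and gives values above `1` on `Ω` outside the ball of
  -- radius `1 / m`. Inside this ball compactness suffices.
  obtain ⟨m, hm, hmS⟩ : ∃ m : ℝ, 0 < m ∧ ∀ w ∈ cone Ω ∩ Metric.sphere 0 1, m < pairing P w := by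
    rcases (cone Ω ∩ Metric.sphere (0 : ℝ × ℝ) 1).eq_empty_or_nonempty with h | h
    · exact ⟨1, one_pos, by simp [h]⟩
    · obtain ⟨z, hz, hmin⟩ := hS.exists_isMinOn h (continuous_pairing_right P).continuousOn
      have hz0 : z ≠ 0 := fun h0 => by simpa [h0] using hz.2
      have := pairing_pos_of_mem_cone hΩ hD hPm hz.1 hz0
      exact ⟨pairing P z / 2, by linarith, fun w hw => by
        have : pairing P z ≤ pairing P w := hmin hw
        linarith⟩
  have hK : IsCompact (Ω ∩ Metric.closedBall 0 (1 / m)) :=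
    (isCompact_closedBall 0 _).inter_left hΩ.closed
  have e1 : ∀ᶠ Q in 𝓝 P, ∀ w ∈ cone Ω ∩ Metric.sphere 0 1, m < pairing Q w :=
    hS.eventually_forall_of_forall_eventually fun w hw =>
      (continuous_pairing.tendsto (P, w)).eventually (lt_mem_nhds (hmS w hw))
  have e2 : ∀ᶠ Q in 𝓝 P, ∀ w ∈ Ω ∩ Metric.closedBall 0 (1 / m), 1 < pairing Q w :=
    hK.eventually_forall_of_forall_eventually fun w hw =>
      (continuous_pairing.tendsto (P, w)).eventually (lt_mem_nhds (hgt w hw.1))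
  refine hP.2 (mem_interior_iff_mem_nhds.2 ?_)
  filter_upwards [e1, e2] with Q h1 h2 w hw
  by_cases hwK : ‖w‖ ≤ 1 / m
  · exact (h2 w ⟨hw, by simpa using hwK⟩).le
  · have hw0 : w ≠ 0 := fun h => hΩ.zero_notMem (h ▸ hw)
    have hn : 0 < ‖w‖ := norm_pos_iff.2 hw0
    have := h1 (‖w‖⁻¹ • w) ⟨smul_mem_cone (by positivity) (subset_cone hw), by
      simp [norm_smul, hn.ne']⟩
    rw [pairing_smul_right, inv_mul_eq_div, lt_div_iff₀ hn] at this
    rw [not_le, div_lt_iff₀ hm] at hwK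
    linarith

/-- Shrinking `w` to `(1 - s) • w` makes the value drop below `1`, so points outside `K` accumulate
at `w`. -/
lemma mem_frontier_of_pairing_eq_one {K : Set (ℝ × ℝ)} (f : StrongDual ℝ (ℝ × ℝ)) {w : ℝ × ℝ}
    (hw : w ∈ K) (hf : ∀ v ∈ K, 1 ≤ f v) (h1 : f w = 1) : w ∈ frontier K := by
  refine ⟨subset_closure hw, fun hi => ?_⟩
  have ht : Tendsto (fun s : ℝ => (1 - s) • w) (𝓝 0) (𝓝 w) := by
    have : Continuous fun s : ℝ => (1 - s) • w := by fun_prop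
    simpa using this.tendsto 0
  obtain ⟨s, hs, hs0⟩ := (((ht.mono_left nhdsWithin_le_nhds).eventually
    (mem_interior_iff_mem_nhds.1 hi)).and (self_mem_nhdsWithin (s := Ioi (0 : ℝ)))).exists
  have := hf _ hs
  rw [map_smul, h1, smul_eq_mul, mul_one] at this
  have : (0 : ℝ) < s := hs0
  linarith

lemma mem_frontier_antipolar {P w : ℝ × ℝ} (hP : P ∈ antipolar Ω) (hw : w ∈ Ω)
    (h : pairing P w = 1) : P ∈ frontier (antipolar Ω) := by
  refine mem_frontier_of_pairing_eq_one
    (w.1 • ContinuousLinearMap.fst ℝ ℝ ℝ - w.2 • ContinuousLinearMap.snd ℝ ℝ ℝ) hP ?_ ?_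
  · intro Q hQ
    simpa [pairing, mul_comm] using hQ w hw
  · simpa [pairing, mul_comm] using h

lemma mem_frontier_of_pairing {P w : ℝ × ℝ} (hP : P ∈ antipolar Ω) (hw : w ∈ Ω)
    (h : pairing P w = 1) : w ∈ frontier Ω := by
  refine mem_frontier_of_pairing_eq_one
    (P.1 • ContinuousLinearMap.fst ℝ ℝ ℝ - P.2 • ContinuousLinearMap.snd ℝ ℝ ℝ) hw ?_ ?_
  · intro v hv
    simpa [pairing, mul_comm] using hP v hv
  · simpa [pairing, mul_comm] using h

/-! ### The anti-norm on the cone -/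

/-- The infimum over `Ω^◇` of the pairing with `w`; on `cone Ω` it is the anti-norm. -/
noncomputable def dualGauge (Ω : Set (ℝ × ℝ)) (w : ℝ × ℝ) : ℝ :=
  sInf ((fun P => pairing P w) '' antipolar Ω)

lemma bddBelow_pairing {w : ℝ × ℝ} (hw : w ∈ cone Ω) :
    BddBelow ((fun P => pairing P w) '' antipolar Ω) :=
  ⟨0, by rintro _ ⟨P, hP, rfl⟩; exact pairing_nonneg_of_mem_cone hP hw⟩

lemma dualGauge_le {P w : ℝ × ℝ} (hP : P ∈ antipolar Ω) (hw : w ∈ cone Ω) :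
    dualGauge Ω w ≤ pairing P w :=
  csInf_le (bddBelow_pairing hw) ⟨P, hP, rfl⟩

lemma le_dualGauge (hΩ : IsBall Ω) {w : ℝ × ℝ} {c : ℝ}
    (h : ∀ P ∈ antipolar Ω, c ≤ pairing P w) : c ≤ dualGauge Ω w :=
  le_csInf (hΩ.antipolar_nonempty.image _) (by rintro _ ⟨P, hP, rfl⟩; exact h P hP)

lemma dualGauge_nonneg (hΩ : IsBall Ω) {w : ℝ × ℝ} (hw : w ∈ cone Ω) : 0 ≤ dualGauge Ω w :=
  le_dualGauge hΩ fun _ hP => pairing_nonneg_of_mem_cone hP hw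

lemma one_le_dualGauge (hΩ : IsBall Ω) {w : ℝ × ℝ} (hw : w ∈ Ω) : 1 ≤ dualGauge Ω w :=
  le_dualGauge hΩ fun _ hP => hP w hw

lemma dualGauge_smul {c : ℝ} (hc : 0 ≤ c) (w : ℝ × ℝ) :
    dualGauge Ω (c • w) = c * dualGauge Ω w := by
  rw [dualGauge, dualGauge, ← smul_eq_mul, ← Real.sInf_smul_of_nonneg hc]
  congr 1
  ext x
  simp [mem_smul_set, pairing_smul_right]

/-- By the bipolar theorem it suffices that every antipolar functional is at least `1` at the
rescaled vector, which is the definition of the infimum. -/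
lemma inv_dualGauge_smul_mem (hΩ : IsBall Ω) {w : ℝ × ℝ} (hw : w ∈ cone Ω)
    (h : 0 < dualGauge Ω w) : (dualGauge Ω w)⁻¹ • w ∈ Ω := by
  refine hΩ.mem_of_forall_pairing fun P hP => ?_
  rw [pairing_smul_right, ← inv_mul_cancel₀ h.ne']
  exact mul_le_mul_of_nonneg_left (dualGauge_le hP hw) (inv_nonneg.2 h.le)

lemma mem_interior_cone_of_dualGauge_pos (hΩ : IsBall Ω) (hD : DualAssumptions Ω) {w : ℝ × ℝ}
    (hw : w ∈ cone Ω) (h : 0 < dualGauge Ω w) : w ∈ interior (cone Ω) := by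
  have := smul_mem_interior_cone h (subset_interior_cone hΩ hD (inv_dualGauge_smul_mem hΩ hw h))
  rwa [smul_smul, mul_inv_cancel₀ h.ne', one_smul] at this

lemma dualGauge_pos_of_mem_interior (hΩ : IsBall Ω) (hD : DualAssumptions Ω) {w : ℝ × ℝ}
    (hw : w ∈ interior (cone Ω)) : 0 < dualGauge Ω w := by
  obtain ⟨s, hs, v, hv, rfl⟩ := exists_pos_smul_of_mem_interior hΩ hD hw
  rw [dualGauge_smul hs.le]
  exact mul_pos hs (zero_lt_one.trans_le (one_le_dualGauge hΩ hv))

/-- The bound on multiples of points of `Ω` survives the upper semicontinuous closure because the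
majorant is continuous. -/
lemma antiNorm_le_pairing {P : ℝ × ℝ} (hP : P ∈ antipolar Ω) (w : ℝ × ℝ) :
    antiNorm Ω w ≤ (pairing P w : EReal) := by
  have h1 : ∀ z, preAntiNorm Ω z ≤ (pairing P z : EReal) := by
    intro z
    refine sSup_le ?_
    rintro _ ⟨s, hs, ⟨v, hv, rfl⟩, rfl⟩
    rw [EReal.coe_le_coe_iff, pairing_smul_right]
    nlinarith [hP v hv]
  calc antiNorm Ω w ≤ limsup (fun z => (pairing P z : EReal)) (𝓝 w) :=
        limsup_le_limsup (Eventually.of_forall h1)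
    _ = (pairing P w : EReal) :=
        ((continuous_coe_real_ereal.comp (continuous_pairing_right P)).tendsto w).limsup_eq

lemma le_preAntiNorm {s : ℝ} (hs : 0 < s) {v : ℝ × ℝ} (hv : v ∈ Ω) :
    (s : EReal) ≤ preAntiNorm Ω (s • v) :=
  le_sSup ⟨s, hs, ⟨v, hv, rfl⟩, rfl⟩

lemma preAntiNorm_le_antiNorm (w : ℝ × ℝ) : preAntiNorm Ω w ≤ antiNorm Ω w :=
  le_limsup_of_frequently_le (frequently_iff.2 fun hU => ⟨w, mem_of_mem_nhds hU, le_rfl⟩)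

/-- On the frontier of the cone `preAntiNorm` is `⊥`, since no positive multiple of a point of `Ω`
lies there. The value is raised by the closure: interior points with positive values accumulate at
every point of the cone. -/
lemma antiNorm_nonneg (hΩ : IsBall Ω) (hD : DualAssumptions Ω) {w : ℝ × ℝ} (hw : w ∈ cone Ω) :
    0 ≤ antiNorm Ω w := by
  have hcl : w ∈ closure (interior (rawCone Ω)) := by
    rwa [hΩ.convex_rawCone.closure_interior_eq_closure_of_nonempty_interior
      (interior_rawCone_nonempty hΩ hD)]
  refine le_limsup_of_frequently_le ((mem_closure_iff_frequently.1 hcl).mono fun z hz => ?_)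
  obtain ⟨s, hs, v, hv, rfl⟩ :=
    exists_pos_smul_of_mem_interior hΩ hD (interior_mono subset_closure hz)
  exact le_trans (by exact_mod_cast hs.le) (le_preAntiNorm hs hv)

/-- Antipolar functionals bound the anti-norm from above. From below, rescaling into `Ω` works where
the gauge is positive, and nonnegativity where it vanishes. The anti-norm is therefore finite on the
cone, so `toReal` loses nothing there. -/
lemma antiNorm_eq_dualGauge (hΩ : IsBall Ω) (hD : DualAssumptions Ω) {w : ℝ × ℝ}
    (hw : w ∈ cone Ω) : antiNorm Ω w = (dualGauge Ω w : EReal) := by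
  obtain ⟨P, hP⟩ := hΩ.antipolar_nonempty
  have hne_top : antiNorm Ω w ≠ ⊤ := ne_top_of_le_ne_top (EReal.coe_ne_top _)
    (antiNorm_le_pairing hP w)
  have hne_bot : antiNorm Ω w ≠ ⊥ := fun h => by
    have := antiNorm_nonneg hΩ hD hw
    rw [h] at this
    exact absurd this (by simp)
  lift antiNorm Ω w to ℝ using ⟨hne_top, hne_bot⟩ with x hx
  have hle : ∀ P ∈ antipolar Ω, x ≤ pairing P w := fun P hP => by
    have := antiNorm_le_pairing hP w
    rwa [← hx, EReal.coe_le_coe_iff] at this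
  rw [EReal.coe_eq_coe_iff]
  refine le_antisymm (le_dualGauge hΩ hle) ?_
  rcases (dualGauge_nonneg hΩ hw).eq_or_lt with h | h
  · have := antiNorm_nonneg hΩ hD hw
    rw [← h]
    rw [← hx] at this
    exact_mod_cast this
  · have h1 := (le_preAntiNorm h (inv_dualGauge_smul_mem hΩ hw h)).trans
      (preAntiNorm_le_antiNorm _)
    rwa [smul_smul, mul_inv_cancel₀ h.ne', one_smul, ← hx, EReal.coe_le_coe_iff] at h1

/-- Boundary points of `Ω` on the same line through the origin coincide. -/
lemma frontier_injOn_rays (hΩ : IsBall Ω)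
    (hstar : ∀ c : ℝ, 1 < c → ∀ w ∈ frontier Ω, c • w ∉ frontier Ω) :
    ∀ w ∈ frontier Ω, ∀ z ∈ frontier Ω, w.1 * z.2 - w.2 * z.1 = 0 → w = z := by
  intro w hw z hz h
  have hwm := hΩ.closed.frontier_subset hw
  have hzm := hΩ.closed.frontier_subset hz
  have hw0 : w ≠ 0 := fun h => hΩ.zero_notMem (h ▸ hwm)
  obtain ⟨c, rfl⟩ : ∃ c : ℝ, z = c • w := by
    by_cases h1 : w.1 = 0
    · have h2 : w.2 ≠ 0 := fun h2 => hw0 (Prod.ext h1 h2)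
      refine ⟨z.2 / w.2, Prod.ext ?_ ?_⟩
      · have : w.2 * z.1 = 0 := by rw [h1] at h; linarith
        simpa [h1, h2] using this
      · simp [h2]
    · refine ⟨z.1 / w.1, Prod.ext ?_ ?_⟩
      · simp [h1]
      · simp only [Prod.smul_snd, smul_eq_mul]
        field_simp
        linarith
  obtain ⟨P, hP⟩ := hΩ.antipolar_nonempty
  have h1 := hP w hwm
  have h2 := hP _ hzm
  rw [pairing_smul_right] at h2
  have hc : 0 < c := by
    by_contra! hneg
    nlinarith
  rcases lt_trichotomy c 1 with hlt | rfl | hgt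
  · have := hstar c⁻¹ ((one_lt_inv₀ hc).2 hlt) _ hz
    rw [smul_smul, inv_mul_cancel₀ hc.ne', one_smul] at this
    exact absurd hw this
  · rw [one_smul]
  · exact absurd hz (hstar c hgt w hw)

/-- A frontier point `c • P` attains the value `1` at some `w ∈ Ω`, which is impossible when `P` is
already at least `1` at `w` and `c > 1`. -/
lemma star_antipolar (hΩ : IsBall Ω) (hD : DualAssumptions Ω) (c : ℝ) (hc : 1 < c)
    (P : ℝ × ℝ) (hP : P ∈ frontier (antipolar Ω)) : c • P ∉ frontier (antipolar Ω) := by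
  intro h
  obtain ⟨w, hw, h1⟩ := exists_pairing_eq_one hΩ hD h
  have := (isClosed_antipolar Ω).frontier_subset hP w hw
  rw [pairing_smul_left] at h1
  nlinarith

/-! ### Sectors and their areas -/

/-- The determinant of two vectors of the plane. -/
def cross (w z : ℝ × ℝ) : ℝ := w.1 * z.2 - w.2 * z.1

lemma cross_swap (w z : ℝ × ℝ) : cross z w = -cross w z := by unfold cross; ring

lemma cross_self (w : ℝ × ℝ) : cross w w = 0 := by unfold cross; ring

lemma continuous_cross : Continuous fun x : (ℝ × ℝ) × (ℝ × ℝ) => cross x.1 x.2 := by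
  unfold cross; fun_prop

/-- The convex cone spanned by two vectors. -/
def sector (w z : ℝ × ℝ) : Set (ℝ × ℝ) :=
  {x | ∃ r s : ℝ, 0 ≤ r ∧ 0 ≤ s ∧ x = r • w + s • z}

/-- The half-open triangle spanned by two vectors. -/
def triangle (w z : ℝ × ℝ) : Set (ℝ × ℝ) :=
  {x | ∃ r s : ℝ, 0 ≤ r ∧ 0 ≤ s ∧ r + s < 1 ∧ x = r • w + s • z}

lemma sector_swap (w z : ℝ × ℝ) : sector z w = sector w z := by
  ext x
  constructor <;> rintro ⟨r, s, hr, hs, rfl⟩ <;> exact ⟨s, r, hs, hr, add_comm _ _⟩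

lemma cross_add_smul_left (r s : ℝ) (w z x : ℝ × ℝ) :
    cross (r • w + s • z) x = r * cross w x + s * cross z x := by
  simp only [cross, Prod.fst_add, Prod.snd_add, Prod.smul_fst, Prod.smul_snd, smul_eq_mul]; ring

lemma cross_add_smul_right (r s : ℝ) (w z x : ℝ × ℝ) :
    cross x (r • w + s • z) = r * cross x w + s * cross x z := by
  simp only [cross, Prod.fst_add, Prod.snd_add, Prod.smul_fst, Prod.smul_snd, smul_eq_mul]; ring

lemma mem_sector_iff {w z : ℝ × ℝ} (h : 0 < cross w z) (x : ℝ × ℝ) :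
    x ∈ sector w z ↔ 0 ≤ cross x z ∧ 0 ≤ cross w x := by
  constructor
  · rintro ⟨r, s, hr, hs, rfl⟩
    rw [cross_add_smul_left, cross_add_smul_right, cross_self, cross_self]
    constructor <;> nlinarith [mul_nonneg hr h.le, mul_nonneg hs h.le]
  · rintro ⟨h1, h2⟩
    -- Cramer's rule in the basis `w, z`.
    refine ⟨cross x z / cross w z, cross w x / cross w z, by positivity, by positivity, ?_⟩
    ext <;> simp only [Prod.fst_add, Prod.snd_add, Prod.smul_fst, Prod.smul_snd, smul_eq_mul] <;>
      field_simp <;> unfold cross <;> ring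

lemma sectorAngle_eq (K : Set (ℝ × ℝ)) (w z : ℝ × ℝ) :
    sectorAngle K w z = Real.sign (cross w z) * (2 * (volume (sector w z \ K)).toReal) := rfl

lemma volume_standard_triangle :
    volume {p : ℝ × ℝ | 0 ≤ p.1 ∧ 0 ≤ p.2 ∧ p.1 + p.2 < 1} = ENNReal.ofReal (1 / 2) := by
  have hm : MeasurableSet {p : ℝ × ℝ | 0 ≤ p.1 ∧ 0 ≤ p.2 ∧ p.1 + p.2 < 1} :=
    (measurableSet_le measurable_const measurable_fst).inter
      ((measurableSet_le measurable_const measurable_snd).inter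
        (measurableSet_lt (measurable_fst.add measurable_snd) measurable_const))
  have hsec : ∀ x : ℝ, volume (Prod.mk x ⁻¹' {p : ℝ × ℝ | 0 ≤ p.1 ∧ 0 ≤ p.2 ∧ p.1 + p.2 < 1}) =
      (Icc (0 : ℝ) 1).indicator (fun x => ENNReal.ofReal (1 - x)) x := by
    intro x
    by_cases hx : 0 ≤ x
    · have : Prod.mk x ⁻¹' {p : ℝ × ℝ | 0 ≤ p.1 ∧ 0 ≤ p.2 ∧ p.1 + p.2 < 1} = Ico 0 (1 - x) := by
        ext y
        simp only [mem_preimage, mem_ofPred_eq, mem_Ico, hx, true_and, lt_sub_iff_add_lt']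
      rw [this, Real.volume_Ico, sub_zero]
      by_cases hx1 : x ≤ 1
      · have hmem : x ∈ Icc (0 : ℝ) 1 := ⟨hx, hx1⟩
        rw [indicator_of_mem hmem]
      · rw [indicator_of_notMem (fun h : x ∈ Icc (0 : ℝ) 1 => hx1 h.2), ENNReal.ofReal_eq_zero]
        linarith
    · have : Prod.mk x ⁻¹' {p : ℝ × ℝ | 0 ≤ p.1 ∧ 0 ≤ p.2 ∧ p.1 + p.2 < 1} = ∅ := by
        ext y
        simp [hx]
      rw [this, measure_empty, indicator_of_notMem (fun h : x ∈ Icc (0 : ℝ) 1 => hx h.1)]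
  rw [Measure.volume_eq_prod, Measure.prod_apply hm, lintegral_congr hsec,
    lintegral_indicator measurableSet_Icc, ← ofReal_integral_eq_lintegral_ofReal]
  · rw [integral_Icc_eq_integral_Ioc, ← intervalIntegral.integral_of_le zero_le_one]
    congr 1
    rw [intervalIntegral.integral_sub (by simp) (by simp)]
    simp; norm_num
  · exact (Continuous.integrableOn_Icc (by fun_prop))
  · filter_upwards [ae_restrict_mem measurableSet_Icc] with x hx
    exact sub_nonneg.2 hx.2

lemma volume_triangle (w z : ℝ × ℝ) :
    volume (triangle w z) = ENNReal.ofReal (|cross w z| / 2) := by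
  set M : Matrix (Fin 2) (Fin 2) ℝ := !![w.1, z.1; w.2, z.2] with hM
  set f := Matrix.toLin (Module.Basis.finTwoProd ℝ) (Module.Basis.finTwoProd ℝ) M
  have hf : ∀ p : ℝ × ℝ, f p = p.1 • w + p.2 • z := fun p => by
    simp only [f, hM, Matrix.toLin_finTwoProd_apply]
    ext <;> simp [mul_comm]
  have himg : triangle w z = f '' {p : ℝ × ℝ | 0 ≤ p.1 ∧ 0 ≤ p.2 ∧ p.1 + p.2 < 1} := by
    ext x
    constructor
    · rintro ⟨r, s, hr, hs, hrs, rfl⟩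
      exact ⟨(r, s), ⟨hr, hs, hrs⟩, hf _⟩
    · rintro ⟨p, ⟨hr, hs, hrs⟩, rfl⟩
      exact ⟨p.1, p.2, hr, hs, hrs, hf _⟩
  rw [himg, Measure.addHaar_image_linearMap, LinearMap.det_toLin, hM, Matrix.det_fin_two_of,
    volume_standard_triangle, ← ENNReal.ofReal_mul (abs_nonneg _), cross]
  congr 1
  rw [mul_comm w.2]; ring

variable {K : Set (ℝ × ℝ)}

/-- If `r + s ≥ 1`, then `r • w + s • z` is `r + s` times a convex combination of `w` and `z`, and
the ray property puts it in `K`. -/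
lemma sector_diff_subset_triangle (hK : IsBall K) {w z : ℝ × ℝ} (hw : w ∈ K) (hz : z ∈ K) :
    sector w z \ K ⊆ triangle w z := by
  rintro _ ⟨⟨r, s, hr, hs, rfl⟩, hx⟩
  refine ⟨r, s, hr, hs, ?_, rfl⟩
  by_contra! h
  have hpos : 0 < r + s := by linarith
  have h1 := hK.ray (r + s) h _ (hK.convex hw hz (a := r / (r + s)) (b := s / (r + s))
    (by positivity) (by positivity) (by field_simp))
  refine hx ?_
  convert h1 using 1
  simp only [smul_add, smul_smul]
  congr 2 <;> field_simp

lemma volume_sector_diff_le (hK : IsBall K) {w z : ℝ × ℝ} (hw : w ∈ K) (hz : z ∈ K) :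
    volume (sector w z \ K) ≤ ENNReal.ofReal (|cross w z| / 2) :=
  (measure_mono (sector_diff_subset_triangle hK hw hz)).trans (volume_triangle w z).le

lemma volume_sector_diff_ne_top (hK : IsBall K) {w z : ℝ × ℝ} (hw : w ∈ K) (hz : z ∈ K) :
    volume (sector w z \ K) ≠ ⊤ :=
  ne_top_of_le_ne_top ENNReal.ofReal_ne_top (volume_sector_diff_le hK hw hz)

lemma toReal_volume_sector_diff_le (hK : IsBall K) {w z : ℝ × ℝ} (hw : w ∈ K) (hz : z ∈ K) :
    2 * (volume (sector w z \ K)).toReal ≤ |cross w z| := by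
  have := ENNReal.toReal_mono ENNReal.ofReal_ne_top (volume_sector_diff_le hK hw hz)
  rw [ENNReal.toReal_ofReal (by positivity)] at this
  linarith

/-- The supporting line `f = 1` through `w` cuts the ray of `z` at `(f z)⁻¹ • z`; the triangle with
vertices `0`, `w` and this point lies in `f < 1` and misses `K`. -/
lemma le_toReal_volume_sector_diff (hK : IsBall K) {w z : ℝ × ℝ} (hw : w ∈ K) (hz : z ∈ K)
    (f : (ℝ × ℝ) →ₗ[ℝ] ℝ) (hf : ∀ v ∈ K, 1 ≤ f v) (hfw : f w = 1) :
    |cross w z| / f z ≤ 2 * (volume (sector w z \ K)).toReal := by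
  have hz1 : 0 < f z := zero_lt_one.trans_le (hf z hz)
  have hsub : triangle w ((f z)⁻¹ • z) ⊆ sector w z \ K := by
    rintro _ ⟨r, s, hr, hs, hrs, rfl⟩
    refine ⟨⟨r, s * (f z)⁻¹, hr, by positivity, by rw [smul_smul]⟩, fun h => ?_⟩
    have := hf _ h
    rw [map_add, map_smul, map_smul, map_smul, hfw, smul_eq_mul, smul_eq_mul, smul_eq_mul,
      inv_mul_cancel₀ hz1.ne', mul_one, mul_one] at this
    linarith
  have h1 := ENNReal.toReal_mono (volume_sector_diff_ne_top hK hw hz) (measure_mono hsub)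
  rw [volume_triangle, ENNReal.toReal_ofReal (by positivity)] at h1
  have h2 : cross w ((f z)⁻¹ • z) = (f z)⁻¹ * cross w z := by
    have := cross_add_smul_right 0 (f z)⁻¹ w z w
    simpa using this
  rw [h2, abs_mul, abs_of_pos (inv_pos.2 hz1)] at h1
  rw [div_eq_inv_mul]
  linarith

lemma abs_sectorAngle_le (hK : IsBall K) {w z : ℝ × ℝ} (hw : w ∈ K) (hz : z ∈ K) :
    |sectorAngle K w z| ≤ |cross w z| := by
  rw [sectorAngle_eq, abs_mul]
  have h1 : |Real.sign (cross w z)| ≤ 1 := by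
    rcases Real.sign_apply_eq (cross w z) with h | h | h <;> simp [h]
  have h2 := toReal_volume_sector_diff_le hK hw hz
  have h3 : 0 ≤ 2 * (volume (sector w z \ K)).toReal := by positivity
  rw [abs_of_nonneg h3]
  nlinarith

lemma sign_mul_abs_self (x : ℝ) : Real.sign x * |x| = x := by
  rcases lt_trichotomy x 0 with h | rfl | h
  · rw [Real.sign_of_neg h, abs_of_neg h]; ring
  · simp
  · rw [Real.sign_of_pos h, abs_of_pos h]; ring

/-- The doubled area lies between `|cross w z| / f z` and `|cross w z|`. The extra factor `f z - 1`
tends to zero as `z` tends to `w`, so the cross product is the first-order part of the angle. -/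
lemma abs_sectorAngle_sub_cross_le (hK : IsBall K) {w z : ℝ × ℝ} (hw : w ∈ K) (hz : z ∈ K)
    (f : (ℝ × ℝ) →ₗ[ℝ] ℝ) (hf : ∀ v ∈ K, 1 ≤ f v) (hfw : f w = 1) :
    |sectorAngle K w z - cross w z| ≤ |cross w z| * (f z - 1) := by
  have h1 := toReal_volume_sector_diff_le hK hw hz
  have h2 := le_toReal_volume_sector_diff hK hw hz f hf hfw
  have hz1 := hf z hz
  set A := 2 * (volume (sector w z \ K)).toReal with hA
  -- This is `2 - y ≤ 1 / y` for `y > 0`, that is, `(y - 1)² ≥ 0`.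
  have h3 : |cross w z| * (2 - f z) ≤ |cross w z| / f z := by
    rw [le_div_iff₀ (by linarith)]
    nlinarith [abs_nonneg (cross w z), mul_nonneg (abs_nonneg (cross w z)) (sq_nonneg (f z - 1))]
  have h4 : sectorAngle K w z - cross w z = Real.sign (cross w z) * (A - |cross w z|) := by
    rw [sectorAngle_eq, ← hA, mul_sub, sign_mul_abs_self]
  have h5 : |Real.sign (cross w z)| ≤ 1 := by
    rcases Real.sign_apply_eq (cross w z) with h | h | h <;> simp [h]
  rw [h4, abs_mul, abs_of_nonpos (by linarith : A - |cross w z| ≤ 0)]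
  nlinarith

lemma sectorAngle_swap (K : Set (ℝ × ℝ)) (w z : ℝ × ℝ) :
    sectorAngle K z w = -sectorAngle K w z := by
  rw [sectorAngle_eq, sectorAngle_eq, cross_swap, sector_swap, Real.sign_neg, neg_mul]

lemma sectorAngle_self (K : Set (ℝ × ℝ)) (w : ℝ × ℝ) : sectorAngle K w w = 0 := by
  rw [sectorAngle_eq, cross_self, Real.sign_zero, zero_mul]

/-- An antipolar functional puts `K` in an open half-plane, where orientation is transitive. The
identity `h` is the linear relation between three vectors of the plane, evaluated on this
functional. -/
lemma cross_pos_trans (hK : IsBall K) {a b c : ℝ × ℝ} (ha : a ∈ K) (hb : b ∈ K) (hc : c ∈ K)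
    (hab : 0 < cross a b) (hbc : 0 < cross b c) : 0 < cross a c := by
  obtain ⟨P, hP⟩ := hK.antipolar_nonempty
  have h : cross b c * pairing P a + cross c a * pairing P b + cross a b * pairing P c = 0 := by
    unfold cross pairing; ring
  rw [cross_swap a c] at h
  have := hP a ha
  have := hP b hb
  have := hP c hc
  by_contra! hneg
  nlinarith [mul_pos hbc (zero_lt_one.trans_le (hP a ha)),
    mul_pos hab (zero_lt_one.trans_le (hP c hc)),
    mul_nonneg (neg_nonneg.2 hneg) (zero_le_one.trans (hP b hb))]

lemma volume_cross_eq_zero {w : ℝ × ℝ} (hw : w ≠ 0) : volume {x | cross w x = 0} = 0 := by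
  let f : (ℝ × ℝ) →ₗ[ℝ] ℝ := w.1 • LinearMap.snd ℝ ℝ ℝ - w.2 • LinearMap.fst ℝ ℝ ℝ
  have hf : ∀ x, f x = cross w x := fun x => by simp [f, cross]
  have hset : {x | cross w x = 0} = (LinearMap.ker f : Set (ℝ × ℝ)) := by
    ext x; simp [hf]
  rw [hset]
  refine Measure.addHaar_submodule volume _ fun h => hw ?_
  have h1 : f (1, 0) = 0 := by
    rw [← LinearMap.mem_ker, h]; trivial
  have h2 : f (0, 1) = 0 := by
    rw [← LinearMap.mem_ker, h]; trivial
  rw [hf] at h1 h2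
  simp only [cross, mul_zero, mul_one, zero_sub, sub_zero, neg_eq_zero] at h1 h2
  exact Prod.ext h2 h1

lemma measurableSet_sector {w z : ℝ × ℝ} (h : 0 < cross w z) : MeasurableSet (sector w z) := by
  have : sector w z = {x | 0 ≤ cross x z} ∩ {x | 0 ≤ cross w x} := by
    ext x; exact mem_sector_iff h x
  rw [this]
  refine (IsClosed.inter ?_ ?_).measurableSet
  · exact isClosed_le continuous_const (continuous_cross.comp (continuous_id.prodMk continuous_const))
  · exact isClosed_le continuous_const (continuous_cross.comp (continuous_const.prodMk continuous_id))

/-- The ray of `b` cuts the sector of `a, c` into two sectors that overlap only on a line, which is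
a null set. -/
lemma sectorAngle_add_of_pos (hK : IsBall K) {a b c : ℝ × ℝ} (ha : a ∈ K) (hb : b ∈ K)
    (hc : c ∈ K) (hab : 0 < cross a b) (hbc : 0 < cross b c) :
    sectorAngle K a c = sectorAngle K a b + sectorAngle K b c := by
  have hac := cross_pos_trans hK ha hb hc hab hbc
  have hb0 : b ≠ 0 := fun h => hK.zero_notMem (h ▸ hb)
  have hunion : sector a c \ K = (sector a b \ K) ∪ (sector b c \ K) := by
    rw [← union_sdiff_distrib]
    congr 1
    ext x
    rw [mem_union, mem_sector_iff hab, mem_sector_iff hbc, mem_sector_iff hac]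
    constructor
    · rintro ⟨h1, h2⟩
      rcases le_total 0 (cross b x) with h | h
      · exact Or.inr ⟨h1, h⟩
      · exact Or.inl ⟨by rw [cross_swap]; linarith, h2⟩
    · have key : cross a c * cross b x = cross b c * cross a x + cross a b * cross c x := by
        unfold cross; ring
      rw [cross_swap x c] at key
      rw [cross_swap b x]
      rintro (⟨h1, h2⟩ | ⟨h1, h2⟩)
      · refine ⟨?_, h2⟩
        by_contra! hn
        nlinarith [mul_nonneg hbc.le h2, mul_pos hab (neg_pos.2 hn),
          mul_nonneg hac.le h1, cross_swap b x]
      · refine ⟨h1, ?_⟩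
        by_contra! hn
        nlinarith [mul_nonneg hab.le h1, mul_pos hbc (neg_pos.2 hn), mul_nonneg hac.le h2]
  have hdisj : AEDisjoint volume (sector a b \ K) (sector b c \ K) := by
    refine measure_mono_null ?_ (volume_cross_eq_zero hb0)
    rintro x ⟨⟨h1, -⟩, ⟨h2, -⟩⟩
    rw [mem_sector_iff hab] at h1
    rw [mem_sector_iff hbc] at h2
    have := h1.1
    rw [cross_swap] at this
    exact le_antisymm (by linarith) h2.2
  rw [sectorAngle_eq, sectorAngle_eq, sectorAngle_eq, Real.sign_of_pos hab, Real.sign_of_pos hbc,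
    Real.sign_of_pos hac, hunion, measure_union₀
      ((measurableSet_sector hbc).diff hK.closed.measurableSet).nullMeasurableSet hdisj,
    ENNReal.toReal_add (volume_sector_diff_ne_top hK ha hb) (volume_sector_diff_ne_top hK hb hc)]
  ring

/-- Additivity of the signed area on the boundary of a ball. -/
lemma sectorAngle_add (hK : IsBall K)
    (hinj : ∀ w ∈ frontier K, ∀ z ∈ frontier K, cross w z = 0 → w = z)
    {a b c : ℝ × ℝ} (ha : a ∈ frontier K) (hb : b ∈ frontier K) (hc : c ∈ frontier K) :
    sectorAngle K a c = sectorAngle K a b + sectorAngle K b c := by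
  have hs : frontier K ⊆ K := hK.closed.frontier_subset
  have hba := sectorAngle_swap K a b
  have hcb := sectorAngle_swap K b c
  have hca := sectorAngle_swap K a c
  have xba := cross_swap a b
  have xcb := cross_swap b c
  have xca := cross_swap a c
  -- If some cross product vanishes, two of the points coincide by `hinj`. Every other sign pattern
  -- is the positively oriented case after reordering the points, up to antisymmetry.
  rcases lt_trichotomy (cross a b) 0 with h1 | h1 | h1
  · rcases lt_trichotomy (cross b c) 0 with h2 | h2 | h2
    · have := sectorAngle_add_of_pos hK (hs hc) (hs hb) (hs ha) (by linarith) (by linarith)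
      linarith
    · obtain rfl := hinj _ hb _ hc h2
      rw [sectorAngle_self, add_zero]
    · rcases lt_trichotomy (cross a c) 0 with h3 | h3 | h3
      · have := sectorAngle_add_of_pos hK (hs hb) (hs hc) (hs ha) (by linarith) (by linarith)
        linarith
      · obtain rfl := hinj _ ha _ hc h3
        rw [sectorAngle_self]; linarith
      · have := sectorAngle_add_of_pos hK (hs hb) (hs ha) (hs hc) (by linarith) (by linarith)
        linarith
  · obtain rfl := hinj _ ha _ hb h1
    rw [sectorAngle_self, zero_add]
  · rcases lt_trichotomy (cross b c) 0 with h2 | h2 | h2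
    · rcases lt_trichotomy (cross a c) 0 with h3 | h3 | h3
      · have := sectorAngle_add_of_pos hK (hs hc) (hs ha) (hs hb) (by linarith) (by linarith)
        linarith
      · obtain rfl := hinj _ ha _ hc h3
        rw [sectorAngle_self]; linarith
      · have := sectorAngle_add_of_pos hK (hs ha) (hs hc) (hs hb) (by linarith) (by linarith)
        linarith
    · obtain rfl := hinj _ hb _ hc h2
      rw [sectorAngle_self, add_zero]
    · exact sectorAngle_add_of_pos hK (hs ha) (hs hb) (hs hc) h1 h2

/-- `K` is closed and avoids the origin, so the open angle contains a non-empty open set near `0`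
that misses `K`. -/
lemma volume_sector_diff_pos (hK : IsBall K) {w z : ℝ × ℝ} (h : 0 < cross w z) :
    0 < volume (sector w z \ K) := by
  set S : Set (ℝ × ℝ) := ({x | 0 < cross x z} ∩ {x | 0 < cross w x}) ∩ Kᶜ
  have hS : IsOpen S := by
    refine ((IsOpen.inter ?_ ?_)).inter hK.closed.isOpen_compl
    · exact isOpen_lt continuous_const
        (continuous_cross.comp (continuous_id.prodMk continuous_const))
    · exact isOpen_lt continuous_const
        (continuous_cross.comp (continuous_const.prodMk continuous_id))
  have hne : S.Nonempty := by
    have ht : Tendsto (fun s : ℝ => s • w + s • z) (𝓝 0) (𝓝 0) := by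
      have : Continuous fun s : ℝ => s • w + s • z := by fun_prop
      simpa using this.tendsto 0
    obtain ⟨s, hs, hs0⟩ := (((ht.mono_left nhdsWithin_le_nhds).eventually
      (hK.closed.isOpen_compl.mem_nhds hK.zero_notMem)).and
        (self_mem_nhdsWithin (s := Ioi (0 : ℝ)))).exists
    have hs0 : 0 < s := hs0
    refine ⟨_, ⟨?_, ?_⟩, hs⟩
    · rw [mem_ofPred_eq, cross_add_smul_left, cross_self]
      nlinarith [mul_pos hs0 h]
    · rw [mem_ofPred_eq, cross_add_smul_right, cross_self]
      nlinarith [mul_pos hs0 h]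
  refine (hS.measure_pos volume hne).trans_le (measure_mono ?_)
  rintro x ⟨⟨h1, h2⟩, h3⟩
  exact ⟨(mem_sector_iff h x).2 ⟨h1.le, h2.le⟩, h3⟩

lemma cross_eq_zero_of_sectorAngle_eq_zero (hK : IsBall K) {w z : ℝ × ℝ} (hw : w ∈ K)
    (hz : z ∈ K) (h : sectorAngle K w z = 0) : cross w z = 0 := by
  by_contra hne
  rcases lt_or_gt_of_ne hne with hlt | hgt
  · have h1 : 0 < cross z w := by rw [cross_swap]; linarith
    have h2 := ENNReal.toReal_pos (volume_sector_diff_pos hK h1).ne'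
      (volume_sector_diff_ne_top hK hz hw)
    rw [sectorAngle_swap, sectorAngle_eq, Real.sign_of_pos h1] at h
    linarith
  · have h2 := ENNReal.toReal_pos (volume_sector_diff_pos hK hgt).ne'
      (volume_sector_diff_ne_top hK hw hz)
    rw [sectorAngle_eq, Real.sign_of_pos hgt] at h
    linarith

lemma injOn_sectorAngle (hK : IsBall K)
    (hinj : ∀ w ∈ frontier K, ∀ z ∈ frontier K, cross w z = 0 → w = z)
    {w₀ : ℝ × ℝ} (hw₀ : w₀ ∈ frontier K) : InjOn (sectorAngle K w₀) (frontier K) := by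
  intro w hw z hz h
  have h1 := sectorAngle_add hK hinj hw₀ hw hz
  exact hinj w hw z hz (cross_eq_zero_of_sectorAngle_eq_zero hK
    (hK.closed.frontier_subset hw) (hK.closed.frontier_subset hz) (by linarith))

lemma trigPoint_sectorAngle (hK : IsBall K)
    (hinj : ∀ w ∈ frontier K, ∀ z ∈ frontier K, cross w z = 0 → w = z)
    {w₀ : ℝ × ℝ} (hw₀ : w₀ ∈ frontier K) {w : ℝ × ℝ} (hw : w ∈ frontier K) :
    trigPoint K w₀ (sectorAngle K w₀ w) = w :=
  (injOn_sectorAngle hK hinj hw₀).leftInvOn_invFunOn hw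

/-! ### Lipschitz functions and almost everywhere derivatives -/

/-- Sets of full measure are dense, so a closed condition on a continuous curve passes from almost
every time to every time. This is how the maximum condition becomes pointwise. -/
lemma forall_mem_of_ae_mem {X : Type*} [TopologicalSpace X] {f : ℝ → X} {A : Set X} {a b : ℝ}
    (hab : a < b) (hf : ContinuousOn f (Icc a b)) (hA : IsClosed A)
    (h : ∀ᵐ t ∂(volume.restrict (Icc a b)), f t ∈ A) : ∀ t ∈ Icc a b, f t ∈ A := by
  intro t ht
  rw [ae_restrict_iff' measurableSet_Icc] at h
  have hd : Dense {t | t ∈ Icc a b → f t ∈ A} := Measure.dense_of_ae h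
  have h1 := hd.open_subset_closure_inter (t := Ioo a b) isOpen_Ioo
  have h2 : t ∈ closure (Ioo a b ∩ {t | t ∈ Icc a b → f t ∈ A}) := by
    have := closure_mono h1
    rw [closure_Ioo hab.ne, closure_closure] at this
    exact this ht
  have h3 : ContinuousWithinAt f (Ioo a b ∩ {t | t ∈ Icc a b → f t ∈ A}) t :=
    (hf t ht).mono (inter_subset_left.trans Ioo_subset_Icc_self)
  exact hA.closure_subset (h3.mem_closure h2 fun s hs => hs.2 (Ioo_subset_Icc_self hs.1))

/-- At almost every point of a level set the derivative vanishes. -/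
lemma ae_hasDerivAt_eq_zero_of_eq (f : ℝ → ℝ) (c : ℝ) :
    ∀ᵐ t : ℝ, f t = c → ∀ d, HasDerivAt f d t → d = 0 := by
  set S : Set ℝ := {t | f t = c ∧ ∃ d, d ≠ 0 ∧ HasDerivAt f d t}
  -- A nonzero derivative isolates a point in its level set. The exceptional set is thus discrete,
  -- hence countable and null.
  have hdisc : DiscreteTopology S := by
    refine discreteTopology_subtype_iff.2 fun t ht => ?_
    obtain ⟨hc, d, hd, hderiv⟩ := ht
    rw [← disjoint_iff, disjoint_principal_right]
    filter_upwards [hderiv.eventually_ne hd (c := c)] with s hs hsS using hs hsS.1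
  have hS : S.Countable := countable_coe_iff.1 countable_of_Lindelof_of_discrete
  filter_upwards [measure_eq_zero_iff_ae_notMem.1 (hS.measure_zero volume)] with t ht hc d hd
  by_contra hne
  exact ht ⟨hc, d, hne, hd⟩

lemma eq_integral_of_ae_hasDerivAt {f g : ℝ → ℝ} {a b : ℝ} {L : NNReal} (hab : a ≤ b)
    (hf : LipschitzOnWith L f (Icc a b)) (hg : ContinuousOn g (Icc a b))
    (h : ∀ᵐ t ∂(volume.restrict (Icc a b)), HasDerivAt f (g t) t) :
    ∃ C, ∀ t ∈ Icc a b, f t = C + ∫ s in a..t, g s := by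
  have hu : uIcc a b = Icc a b := uIcc_of_le hab
  have hgi : IntervalIntegrable g volume a b := (hu ▸ hg).intervalIntegrable
  have hfa : AbsolutelyContinuousOnInterval f a b :=
    LipschitzOnWith.absolutelyContinuousOnInterval (hu ▸ hf)
  have hga : AbsolutelyContinuousOnInterval (fun t => ∫ s in a..t, g s) a b :=
    hgi.absolutelyContinuousOnInterval_intervalIntegral (c := a) (by simp)
  rw [ae_restrict_iff' measurableSet_Icc] at h
  have ha : ∀ᵐ t : ℝ, t ≠ a := by simp [ae_iff, measure_singleton]
  have hb : ∀ᵐ t : ℝ, t ≠ b := by simp [ae_iff, measure_singleton]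
  obtain ⟨C, hC⟩ := (hfa.sub hga).const_of_ae_hasDerivAt_zero (by
    filter_upwards [h, ha, hb] with t ht hta htb htu
    rw [hu] at htu
    have hto : t ∈ Ioo a b := ⟨htu.1.lt_of_ne hta.symm, htu.2.lt_of_ne htb⟩
    have hd := intervalIntegral.integral_hasDerivAt_right
      (hgi.mono_set (by rw [hu, uIcc_of_le htu.1]; exact Icc_subset_Icc_right htu.2))
      (ContinuousOn.stronglyMeasurableAtFilter isOpen_Ioo (hg.mono Ioo_subset_Icc_self) t hto)
      (hg.continuousAt (Icc_mem_nhds hto.1 hto.2))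
    simpa using (ht htu).sub hd)
  refine ⟨C, fun t ht => ?_⟩
  have := hC t (hu ▸ ht)
  simp only [Pi.sub_apply] at this
  linarith

/-- A Lipschitz function is the integral of its almost everywhere derivative. When the latter is
continuous, the fundamental theorem of calculus applies at every interior point. -/
lemma hasDerivAt_of_ae_hasDerivAt {f g : ℝ → ℝ} {a b : ℝ} {L : NNReal}
    (hf : LipschitzOnWith L f (Icc a b)) (hg : ContinuousOn g (Icc a b))
    (h : ∀ᵐ t ∂(volume.restrict (Icc a b)), HasDerivAt f (g t) t) {t : ℝ} (ht : t ∈ Ioo a b) :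
    HasDerivAt f (g t) t := by
  have hab : a ≤ b := (ht.1.trans ht.2).le
  obtain ⟨C, hC⟩ := eq_integral_of_ae_hasDerivAt hab hf hg h
  have hd := intervalIntegral.integral_hasDerivAt_right
    (ContinuousOn.intervalIntegrable (u := g) (μ := volume) (a := a) (b := t)
      (hg.mono (by rw [uIcc_of_le ht.1.le]; exact Icc_subset_Icc_right ht.2.le)))
    (ContinuousOn.stronglyMeasurableAtFilter isOpen_Ioo (hg.mono Ioo_subset_Icc_self) t ht)
    (hg.continuousAt (Icc_mem_nhds ht.1 ht.2))
  refine (hd.const_add C).congr_of_eventuallyEq ?_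
  filter_upwards [Icc_mem_nhds ht.1 ht.2] with s hs using hC s hs

lemma eq_of_ae_hasDerivAt_zero {f : ℝ → ℝ} {a b : ℝ}
    (hf : AbsolutelyContinuousOnInterval f a b) (hab : a ≤ b)
    (h : ∀ᵐ t ∂(volume.restrict (Icc a b)), HasDerivAt f 0 t) : ∀ t ∈ Icc a b, f t = f a := by
  rw [ae_restrict_iff' measurableSet_Icc] at h
  obtain ⟨C, hC⟩ := hf.const_of_ae_hasDerivAt_zero (by rwa [uIcc_of_le hab])
  rw [uIcc_of_le hab] at hC
  intro t ht
  rw [hC t ht, hC a (left_mem_Icc.2 hab)]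

/-! ### The angle along a curve on the boundary -/

/-- By additivity the base point may be moved to `γ t₀`. From there the angle differs from `cross (γ
t₀) (γ t)` by at most `|cross| * (f - 1)`, which is `O(t - t₀) * o(1)`. Only one supporting
functional at `γ t₀` is needed, not smoothness of the boundary. -/
lemma hasDerivAt_sectorAngle (hK : IsBall K)
    (hinj : ∀ w ∈ frontier K, ∀ z ∈ frontier K, cross w z = 0 → w = z)
    {w₀ : ℝ × ℝ} (hw₀ : w₀ ∈ frontier K) {γ : ℝ → ℝ × ℝ} {t₀ : ℝ} {d : ℝ × ℝ}
    (hγ : ∀ᶠ t in 𝓝 t₀, γ t ∈ frontier K) (hd : HasDerivAt γ d t₀)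
    (f : (ℝ × ℝ) →ₗ[ℝ] ℝ) (hf : ∀ v ∈ K, 1 ≤ f v) (hfw : f (γ t₀) = 1) :
    HasDerivAt (fun t => sectorAngle K w₀ (γ t)) (cross (γ t₀) d) t₀ := by
  have hφ : HasDerivAt (fun t => cross (γ t₀) (γ t)) (cross (γ t₀) d) t₀ := by
    have h1 : HasDerivAt (fun t => (γ t).1) d.1 t₀ := hd.fst
    have h2 : HasDerivAt (fun t => (γ t).2) d.2 t₀ := hd.snd
    exact (h2.const_mul _).sub (h1.const_mul _)
  have h0 : γ t₀ ∈ frontier K := hγ.self_of_nhds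
  have hO : (fun t => cross (γ t₀) (γ t)) =O[𝓝 t₀] fun t => t - t₀ := by
    simpa [cross_self] using hφ.isBigO_sub
  have ho : (fun t => f (γ t) - 1) =o[𝓝 t₀] fun _ => (1 : ℝ) := by
    rw [Asymptotics.isLittleO_one_iff]
    have hc : ContinuousAt (fun t => f (γ t) - 1) t₀ :=
      ((LinearMap.continuous_of_finiteDimensional f).continuousAt.comp hd.continuousAt).sub
        continuousAt_const
    simpa [ContinuousAt, hfw] using hc
  have hprod := hO.mul_isLittleO ho
  have hsmall : (fun t => sectorAngle K (γ t₀) (γ t) - cross (γ t₀) (γ t)) =o[𝓝 t₀]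
      fun t => (t - t₀) * 1 := by
    refine Asymptotics.IsBigO.trans_isLittleO (Asymptotics.IsBigO.of_bound 1 ?_) hprod
    filter_upwards [hγ] with t ht
    have h1 := abs_sectorAngle_sub_cross_le hK (hK.closed.frontier_subset h0)
      (hK.closed.frontier_subset ht) f hf hfw
    have h2 := hf _ (hK.closed.frontier_subset ht)
    rw [Real.norm_eq_abs, Real.norm_eq_abs, abs_mul, one_mul, abs_of_nonneg (sub_nonneg.2 h2)]
    exact h1
  rw [hasDerivAt_iff_isLittleO] at hφ ⊢
  refine (hφ.add (by simpa using hsmall)).congr' ?_ EventuallyEq.rfl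
  filter_upwards [hγ] with t ht
  rw [sectorAngle_add hK hinj hw₀ h0 ht, cross_self]
  ring

lemma norm_cross_le (w z : ℝ × ℝ) : |cross w z| ≤ 2 * ‖w‖ * ‖z‖ := by
  have := norm_pairing_le (w.1, w.2) (z.2, z.1)
  simpa [pairing, cross, Prod.norm_def, max_comm] using this

lemma lipschitzOnWith_sectorAngle (hK : IsBall K)
    (hinj : ∀ w ∈ frontier K, ∀ z ∈ frontier K, cross w z = 0 → w = z)
    {w₀ : ℝ × ℝ} (hw₀ : w₀ ∈ frontier K) {γ : ℝ → ℝ × ℝ} {a b : ℝ} {L : NNReal}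
    (hγ : ∀ t ∈ Icc a b, γ t ∈ frontier K) (hL : LipschitzOnWith L γ (Icc a b)) :
    ∃ L', LipschitzOnWith L' (fun t => sectorAngle K w₀ (γ t)) (Icc a b) := by
  obtain ⟨M, hM⟩ := (isCompact_Icc.image_of_continuousOn hL.continuousOn).isBounded.exists_norm_le
  have hM' : ∀ t ∈ Icc a b, ‖γ t‖ ≤ max M 0 := fun t ht =>
    (hM _ ⟨t, ht, rfl⟩).trans (le_max_left _ _)
  refine ⟨Real.toNNReal (2 * max M 0 * L), LipschitzOnWith.of_dist_le_mul fun s hs t ht => ?_⟩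
  have hpos : 0 ≤ max M 0 := le_max_right _ _
  rw [Real.coe_toNNReal _ (by positivity), Real.dist_eq,
    sectorAngle_add hK hinj hw₀ (hγ t ht) (hγ s hs), add_sub_cancel_left]
  calc |sectorAngle K (γ t) (γ s)| ≤ |cross (γ t) (γ s)| := abs_sectorAngle_le hK
        (hK.closed.frontier_subset (hγ t ht)) (hK.closed.frontier_subset (hγ s hs))
    _ = |cross (γ t) (γ s - γ t)| := by congr 1; simp only [cross, Prod.fst_sub, Prod.snd_sub]; ring
    _ ≤ 2 * ‖γ t‖ * ‖γ s - γ t‖ := norm_cross_le _ _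
    _ ≤ 2 * max M 0 * (L * dist s t) := by
      rw [← dist_eq_norm]
      gcongr
      · exact hM' t ht
      · exact hL.dist_le_mul s hs t ht
    _ = _ := by ring

/-- Separation of variables for `η' = y` with `y` continuous and of constant sign. -/
lemma sub_eq_integral_of_hasDerivAt {η y g : ℝ → ℝ} {α β σ : ℝ} (hσ : σ = 1 ∨ σ = -1)
    (hη : ∀ t ∈ Ioo α β, HasDerivAt η (y t) t) (hy : ∀ t ∈ Ioo α β, 0 < σ * y t)
    (hg : ∀ t ∈ Ioo α β, g (η t) = 1 / (σ * y t)) {t₁ t₂ : ℝ} (h₁ : t₁ ∈ Ioo α β)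
    (h₂ : t₂ ∈ Ioo α β) :
    IntervalIntegrable g volume (η t₁) (η t₂) ∧ t₂ - t₁ = σ * ∫ s in (η t₁)..(η t₂), g s := by
  have hsub : uIcc t₁ t₂ ⊆ Ioo α β := ordConnected_Ioo.uIcc_subset h₁ h₂
  have hsub' : Ioo (min t₁ t₂) (max t₁ t₂) ⊆ Ioo α β := Ioo_subset_Icc_self.trans hsub
  have hc : ContinuousOn η (uIcc t₁ t₂) := fun t ht =>
    (hη t (hsub ht)).continuousAt.continuousWithinAt
  have hσσ : σ * σ = 1 := by rcases hσ with rfl | rfl <;> norm_num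
  have hconst : EqOn (fun t => (g ∘ η) t * y t) (fun _ => σ) (uIcc t₁ t₂) := fun t ht => by
    have h := hy t (hsub ht)
    have hσ0 : σ ≠ 0 := by rintro rfl; simp at hσσ
    have hy0 : y t ≠ 0 := by intro h0; simp [h0] at h
    simp only [Function.comp_apply, hg t (hsub ht)]
    field_simp
    linarith
  have hint : IntervalIntegrable (fun t => (g ∘ η) t * y t) volume t₁ t₂ :=
    (intervalIntegrable_const (c := σ)).congr
      (fun t ht => (hconst (uIoc_subset_uIcc ht)).symm)
  have hval : ∫ t in t₁..t₂, (g ∘ η) t * y t = σ * (t₂ - t₁) := by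
    rw [intervalIntegral.integral_congr hconst]; simp [mul_comm]
  -- The function `η` is monotone, with direction given by `σ`. The monotone change of variables
  -- needs no continuity of `g` and also transfers integrability from the constant integrand `σ`.
  have key : IntervalIntegrable g volume (η t₁) (η t₂) ∧
      ∫ t in t₁..t₂, (g ∘ η) t * y t = ∫ s in (η t₁)..(η t₂), g s := by
    rcases hσ with rfl | rfl
    · have hs : ∀ t ∈ Ioo (min t₁ t₂) (max t₁ t₂), 0 ≤ y t := fun t ht => by
        linarith [hy t (hsub' ht)]
      exact ⟨(intervalIntegral.integrable_comp_mul_deriv_iff_of_deriv_nonneg hc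
        (fun t ht => hη t (hsub' ht)) hs).1 hint,
        intervalIntegral.integral_comp_mul_deriv_of_deriv_nonneg hc
        (fun t ht => hη t (hsub' ht)) hs⟩
    · have hs : ∀ t ∈ Ioo (min t₁ t₂) (max t₁ t₂), y t ≤ 0 := fun t ht => by
        linarith [hy t (hsub' ht)]
      exact ⟨(intervalIntegral.integrable_comp_mul_deriv_iff_of_deriv_nonpos hc
        (fun t ht => hη t (hsub' ht)) hs).1 hint,
        intervalIntegral.integral_comp_mul_deriv_of_deriv_nonpos hc
        (fun t ht => hη t (hsub' ht)) hs⟩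
  refine ⟨key.1, ?_⟩
  rw [← key.2, hval, ← mul_assoc, hσσ, one_mul]

/-! ### Adapted bases of three-dimensional unimodular Lie algebras -/

section LieAlgebra

variable {L : Type*} [LieRing L] [LieAlgebra ℝ L]

/-- For a basis `e` of a unimodular Lie algebra with `e 2 = [e 0, e 1]`, the operator `ad (e 2)`
preserves the span of `e 0, e 1` and is traceless there. -/
lemma exists_lie_eq_of_unimodular (htr : ∀ x : L, LinearMap.trace ℝ L (LieAlgebra.ad ℝ L x) = 0)
    (e : Module.Basis (Fin 3) ℝ L) (he : e 2 = ⁅e 0, e 1⁆) :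
    ∃ α β δ : ℝ, ⁅e 2, e 0⁆ = α • e 0 + β • e 1 ∧ ⁅e 2, e 1⁆ = δ • e 0 + (-α) • e 1 := by
  have htrace : ∀ x : L, e.repr ⁅x, e 0⁆ 0 + e.repr ⁅x, e 1⁆ 1 + e.repr ⁅x, e 2⁆ 2 = 0 := by
    intro x
    have := htr x
    rw [LinearMap.trace_eq_matrix_trace ℝ e, Matrix.trace, Fin.sum_univ_three] at this
    simpa [LinearMap.toMatrix_apply] using this
  have hrepr : ∀ x : L, x = e.repr x 0 • e 0 + e.repr x 1 • e 1 + e.repr x 2 • e 2 := fun x => by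
    conv_lhs => rw [← e.sum_repr x, Fin.sum_univ_three]
  -- Vanishing traces of `ad (e 0)` and `ad (e 1)` kill the `e 2`-components of the two brackets;
  -- the trace of `ad (e 2)` makes the remaining 2×2 block traceless.
  have h0 := htrace (e 0)
  have h1 := htrace (e 1)
  have h2 := htrace (e 2)
  rw [← he, lie_self, ← lie_skew (e 0) (e 2)] at h0
  rw [lie_self, ← lie_skew (e 1) (e 0), ← he, ← lie_skew (e 1) (e 2)] at h1
  rw [lie_self] at h2
  simp [-lie_skew] at h0 h1 h2
  refine ⟨e.repr ⁅e 2, e 0⁆ 0, e.repr ⁅e 2, e 0⁆ 1, e.repr ⁅e 2, e 1⁆ 0, ?_, ?_⟩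
  · conv_lhs => rw [hrepr ⁅e 2, e 0⁆]
    rw [h0, zero_smul, add_zero]
  · conv_lhs => rw [hrepr ⁅e 2, e 1⁆]
    rw [h1, zero_smul, add_zero, show e.repr ⁅e 2, e 1⁆ 1 = -e.repr ⁅e 2, e 0⁆ 0 by linarith]

/-- Rescaling turns an antidiagonal matrix of `ad [f₁, f₂]` into one with entries `0, ±1`. -/
lemma exists_rescaling {f₁ f₂ : L} {A B : ℝ} (h₁ : ⁅⁅f₁, f₂⁆, f₁⁆ = A • f₂)
    (h₂ : ⁅⁅f₁, f₂⁆, f₂⁆ = B • f₁) :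
    ∃ s r a b : ℝ, s ≠ 0 ∧ r ≠ 0 ∧ (a = 0 ∨ a = 1 ∨ a = -1) ∧ (b = 0 ∨ b = 1 ∨ b = -1) ∧
      ⁅⁅s • f₁, r • f₂⁆, s • f₁⁆ = a • r • f₂ ∧ ⁅⁅s • f₁, r • f₂⁆, r • f₂⁆ = b • s • f₁ := by
  -- Replacing `f₁, f₂` by `s • f₁, r • f₂` multiplies `A` by `s²` and `B` by `r²`, so the two
  -- coefficients are normalized independently.
  have key : ∀ A : ℝ, ∃ s a : ℝ, s ≠ 0 ∧ (a = 0 ∨ a = 1 ∨ a = -1) ∧ s * s * A = a := by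
    intro A
    rcases lt_trichotomy A 0 with h | rfl | h
    · refine ⟨(√(-A))⁻¹, -1, inv_ne_zero (Real.sqrt_pos.2 (by linarith)).ne', by simp, ?_⟩
      rw [← mul_inv, Real.mul_self_sqrt (by linarith), inv_neg, neg_mul, inv_mul_cancel₀ h.ne]
    · exact ⟨1, 0, one_ne_zero, by simp, by simp⟩
    · refine ⟨(√A)⁻¹, 1, inv_ne_zero (Real.sqrt_pos.2 h).ne', by simp, ?_⟩
      rw [← mul_inv, Real.mul_self_sqrt h.le]
      field_simp
  obtain ⟨s, a, hs, ha, hsa⟩ := key A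
  obtain ⟨r, b, hr, hb, hrb⟩ := key B
  refine ⟨s, r, a, b, hs, hr, ha, hb, ?_, ?_⟩
  · simp only [lie_smul, smul_lie, h₁, smul_smul, ← hsa]
    congr 1; ring
  · simp only [lie_smul, smul_lie, h₂, smul_smul, ← hrb]
    congr 1; ring

lemma span_pair_smul {s r : ℝ} (hs : s ≠ 0) (hr : r ≠ 0) (f₁ f₂ : L) :
    Submodule.span ℝ {s • f₁, r • f₂} = Submodule.span ℝ {f₁, f₂} := by
  rw [Submodule.span_insert, Submodule.span_insert, Submodule.span_singleton_smul_eq hs.isUnit,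
    Submodule.span_singleton_smul_eq hr.isUnit]

lemma lie_notMem_of_span_eq {W : Submodule ℝ L} {f₁ f₂ : L}
    (hW : Submodule.span ℝ {f₁, f₂} = W) (hgen : ∃ x ∈ W, ∃ y ∈ W, ⁅x, y⁆ ∉ W) :
    ⁅f₁, f₂⁆ ∉ W := by
  obtain ⟨x, hx, y, hy, hxy⟩ := hgen
  intro h
  rw [← hW, Submodule.mem_span_pair] at hx hy
  obtain ⟨a, b, rfl⟩ := hx
  obtain ⟨c, d, rfl⟩ := hy
  refine hxy ?_
  have : ⁅a • f₁ + b • f₂, c • f₁ + d • f₂⁆ = (a * d - b * c) • ⁅f₁, f₂⁆ := by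
    simp only [add_lie, lie_add, smul_lie, lie_smul, lie_self, smul_zero, zero_add, add_zero]
    rw [← lie_skew f₁ f₂]
    module
  rw [this]
  exact W.smul_mem _ h

/-- A traceless 2×2 matrix `M` satisfies `M² = -det M` by Cayley–Hamilton, so it is antidiagonal in
the basis `v, M v` whenever `v` is not an eigenvector. One of `e₀`, `e₁` serves as `v` unless `M` is
diagonal, and then `e₀ + e₁`, `e₀ - e₁` works. Changing the basis also multiplies `[f₁, f₂]` by the
determinant, which explains the extra factors in `A` and `B`. -/
lemma exists_antidiagonal [FiniteDimensional ℝ L] (h3 : Module.finrank ℝ L = 3)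
    (htr : ∀ x : L, LinearMap.trace ℝ L (LieAlgebra.ad ℝ L x) = 0)
    (W : Submodule ℝ L) (hW : Module.finrank ℝ W = 2) (hgen : ∃ x ∈ W, ∃ y ∈ W, ⁅x, y⁆ ∉ W) :
    ∃ (f₁ f₂ : L) (A B : ℝ), Submodule.span ℝ {f₁, f₂} = W ∧ ⁅⁅f₁, f₂⁆, f₁⁆ = A • f₂ ∧
      ⁅⁅f₁, f₂⁆, f₂⁆ = B • f₁ := by
  obtain ⟨e₀, e₁, hspan⟩ : ∃ e₀ e₁ : L, Submodule.span ℝ {e₀, e₁} = W := by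
    let b := Module.finBasisOfFinrankEq ℝ W hW
    refine ⟨b 0, b 1, ?_⟩
    have := congrArg (Submodule.map W.subtype) b.span_eq
    rw [Submodule.map_span, Submodule.map_top, Submodule.range_subtype, ← range_comp] at this
    refine Eq.trans ?_ this
    congr 1
    ext x
    simp [Fin.exists_fin_two, eq_comm]
  have hbr := lie_notMem_of_span_eq hspan hgen
  have hli : LinearIndependent ℝ ![e₀, e₁] := by
    rw [linearIndependent_iff_card_eq_finrank_span]
    rw [Set.finrank, Matrix.range_cons_cons_empty, hspan, hW, Fintype.card_fin]
  have hli3 : LinearIndependent ℝ ![e₀, e₁, ⁅e₀, e₁⁆] := by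
    have hsnoc : ![e₀, e₁, ⁅e₀, e₁⁆] = Fin.snoc (α := fun _ => L) ![e₀, e₁] ⁅e₀, e₁⁆ := by
      funext i
      fin_cases i <;> rfl
    rw [hsnoc]
    refine linearIndependent_finSnoc.2 ⟨hli, ?_⟩
    rwa [Matrix.range_cons_cons_empty, hspan]
  let e := basisOfLinearIndependentOfCardEqFinrank hli3 (by simp [h3])
  have he0 : e 0 = e₀ := by simp [e]
  have he1 : e 1 = e₁ := by simp [e]
  have he2 : e 2 = ⁅e₀, e₁⁆ := by simp [e]
  obtain ⟨α, β, δ, h1, h2⟩ := exists_lie_eq_of_unimodular htr e (by rw [he0, he1, he2])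
  rw [he0, he1, he2] at h1 h2
  have hpair : ∀ f₁ f₂ : L, (∃ x y : ℝ, x • e₀ + y • e₁ = f₁) → (∃ x y : ℝ, x • e₀ + y • e₁ = f₂) →
      (∃ x y : ℝ, x • f₁ + y • f₂ = e₀) → (∃ x y : ℝ, x • f₁ + y • f₂ = e₁) →
      Submodule.span ℝ {f₁, f₂} = W := by
    intro f₁ f₂ h1 h2 h3 h4
    simp only [← Submodule.mem_span_pair] at h1 h2 h3 h4
    rw [← hspan]
    refine le_antisymm (Submodule.span_le.2 ?_) (Submodule.span_le.2 ?_)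
    · rintro _ (rfl | rfl) <;> assumption
    · rintro _ (rfl | rfl) <;> assumption
  by_cases hβ : β = 0
  · by_cases hδ : δ = 0
    · subst hβ hδ
      have h3 : ⁅e₀ + e₁, e₀ - e₁⁆ = (-2 : ℝ) • ⁅e₀, e₁⁆ := by
        simp only [add_lie, lie_sub, lie_self]
        rw [← lie_skew e₀ e₁]
        module
      refine ⟨e₀ + e₁, e₀ - e₁, -2 * α, -2 * α, hpair _ _ ⟨1, 1, by module⟩ ⟨1, -1, by module⟩
        ⟨1 / 2, 1 / 2, by module⟩ ⟨1 / 2, -1 / 2, by module⟩, ?_, ?_⟩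
      · rw [h3, smul_lie, lie_add, h1, h2]; module
      · rw [h3, smul_lie, lie_sub, h1, h2]; module
    · have h3 : ⁅e₁, δ • e₀ + (-α) • e₁⁆ = (-δ) • ⁅e₀, e₁⁆ := by
        simp only [lie_add, lie_smul, lie_self]
        rw [← lie_skew e₀ e₁]
        module
      refine ⟨e₁, δ • e₀ + (-α) • e₁, -δ, -δ * (δ * β + α * α), hpair _ _ ⟨0, 1, by module⟩
        ⟨δ, -α, rfl⟩ ⟨α / δ, 1 / δ, ?_⟩ ⟨1, 0, by module⟩, ?_, ?_⟩
      · match_scalars <;> field_simp; ring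
      · rw [h3, smul_lie, h2]
      · rw [h3, smul_lie, lie_add, lie_smul, lie_smul, h1, h2]; module
  · have h3 : ⁅e₀, α • e₀ + β • e₁⁆ = β • ⁅e₀, e₁⁆ := by
      simp only [lie_add, lie_smul, lie_self]
      module
    refine ⟨e₀, α • e₀ + β • e₁, β, β * (δ * β + α * α), hpair _ _ ⟨1, 0, by module⟩
      ⟨α, β, rfl⟩ ⟨1, 0, by module⟩ ⟨-α / β, 1 / β, ?_⟩, ?_, ?_⟩
    · match_scalars <;> field_simp; ring
    · rw [h3, smul_lie, h1]
    · rw [h3, smul_lie, lie_add, lie_smul, lie_smul, h1, h2]; module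

lemma exists_adapted_basis [FiniteDimensional ℝ L] (h3 : Module.finrank ℝ L = 3)
    (htr : ∀ x : L, LinearMap.trace ℝ L (LieAlgebra.ad ℝ L x) = 0)
    (W : Submodule ℝ L) (hW : Module.finrank ℝ W = 2) (hgen : ∃ x ∈ W, ∃ y ∈ W, ⁅x, y⁆ ∉ W) :
    ∃ (a b : ℝ) (f₁ f₂ : L), Submodule.span ℝ {f₁, f₂} = W ∧ ⁅f₁, f₂⁆ ∉ W ∧
      ⁅⁅f₁, f₂⁆, f₁⁆ = a • f₂ ∧ ⁅⁅f₁, f₂⁆, f₂⁆ = b • f₁ ∧ (a = 0 ∨ a = 1 ∨ a = -1) ∧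
      (b = 0 ∨ b = 1 ∨ b = -1) ∧ 0 ≤ a + b := by
  obtain ⟨f₁, f₂, A, B, hspan, hA, hB⟩ := exists_antidiagonal h3 htr W hW hgen
  obtain ⟨s, r, a, b, hs, hr, ha, hb, h1, h2⟩ := exists_rescaling hA hB
  rw [← span_pair_smul hs hr] at hspan
  rcases le_total 0 (a + b) with h | h
  · exact ⟨a, b, _, _, hspan, lie_notMem_of_span_eq hspan hgen, h1, h2, ha, hb, h⟩
  -- Interchanging `f₁` and `f₂` reverses the sign of their bracket and turns `(a, b)` into `(-b,
  -- -a)`, making the sum nonnegative.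
  · have hspan' := hspan
    rw [pair_comm] at hspan'
    refine ⟨-b, -a, _, _, hspan', lie_notMem_of_span_eq hspan' hgen, ?_, ?_, ?_, ?_, by linarith⟩
    · rw [← lie_skew (r • f₂) (s • f₁), neg_lie, h2, neg_smul]
    · rw [← lie_skew (r • f₂) (s • f₁), neg_lie, h1, neg_smul]
    · rcases hb with rfl | rfl | rfl <;> simp
    · rcases ha with rfl | rfl | rfl <;> simp

end LieAlgebra

/-! ### Reduction of extremals to the momenta -/

section Momentum

variable {G : Type*} [TopologicalSpace G] [ChartedSpace (EuclideanSpace ℝ (Fin 3)) G] [Group G]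

lemma momentum_add {g : G} (p : TangentSpace (𝓡 3) g →L[ℝ] ℝ) (x y : GroupLieAlgebra (𝓡 3) G) :
    momentum p (x + y) = momentum p x + momentum p y := by
  rw [momentum, mulInvariantVectorField_add, Pi.add_apply, map_add]; rfl

lemma momentum_smul {g : G} (p : TangentSpace (𝓡 3) g →L[ℝ] ℝ) (c : ℝ)
    (x : GroupLieAlgebra (𝓡 3) G) : momentum p (c • x) = c * momentum p x := by
  rw [momentum, mulInvariantVectorField_smul, Pi.smul_apply, map_smul]; rfl

lemma momentum_neg {g : G} (p : TangentSpace (𝓡 3) g →L[ℝ] ℝ)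
    (x : GroupLieAlgebra (𝓡 3) G) : momentum p (-x) = -momentum p x := by
  rw [← neg_one_smul ℝ, momentum_smul, neg_one_mul]

/-- The momentum as a linear form on the Lie algebra. -/
noncomputable def momentumMap {g : G} (p : TangentSpace (𝓡 3) g →L[ℝ] ℝ) :
    GroupLieAlgebra (𝓡 3) G →ₗ[ℝ] ℝ where
  toFun := momentum p
  map_add' := momentum_add p
  map_smul' := momentum_smul p

lemma finrank_groupLieAlgebra : Module.finrank ℝ (GroupLieAlgebra (𝓡 3) G) = 3 :=
  finrank_euclideanSpace_fin (𝕜 := ℝ) (n := 3)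

variable [LieGroup (𝓡 3) (minSmoothness ℝ 3) G]

/-- The differential of left translation by `g` is onto because translation by `g⁻¹` inverts it.
Hence a nonzero covector has a nonzero momentum. -/
lemma exists_mulInvariantVectorField_eq (g : G) (v : TangentSpace (𝓡 3) g) :
    ∃ x : GroupLieAlgebra (𝓡 3) G, mulInvariantVectorField x g = v := by
  have M : minSmoothness ℝ 3 ≠ 0 := (lt_of_lt_of_le (by simp) le_minSmoothness).ne'
  have hd : ∀ g h : G, MDifferentiableAt (𝓡 3) (𝓡 3) (g * ·) h := fun g h =>
    contMDiff_mul_left.contMDiffAt.mdifferentiableAt M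
  have hcomp : (fun x => g * x) ∘ (fun x => g⁻¹ * x) = id := by ext x; simp
  have h1 : HasMFDerivAt (𝓡 3) (𝓡 3) (fun x => g⁻¹ * x) g
      (mfderiv (𝓡 3) (𝓡 3) (fun x => g⁻¹ * x) g) := (hd _ _).hasMFDerivAt
  have h2 : HasMFDerivAt (𝓡 3) (𝓡 3) (fun x => g * x) (g⁻¹ * g)
      (mfderiv (𝓡 3) (𝓡 3) (fun x => g * x) (g⁻¹ * g)) := (hd _ _).hasMFDerivAt
  have h3 := h2.comp g h1
  rw [hcomp] at h3
  have h4 := hasMFDerivAt_unique h3 (hasMFDerivAt_id g)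
  have h5 : (g⁻¹ * g : G) = 1 := inv_mul_cancel g
  have h6 := DFunLike.congr_fun h4 v
  -- The chain rule yields the differential at `g⁻¹ * g`. Its base point is moved to `1` after all
  -- tangent spaces are read as the same model space.
  have key : ∀ e : G, e = 1 → ∀ x w : EuclideanSpace ℝ (Fin 3),
      (mfderiv (𝓡 3) (𝓡 3) (fun x => g * x) e :
        EuclideanSpace ℝ (Fin 3) →L[ℝ] EuclideanSpace ℝ (Fin 3)) x = w →
      (mfderiv (𝓡 3) (𝓡 3) (fun x => g * x) (1 : G) :
        EuclideanSpace ℝ (Fin 3) →L[ℝ] EuclideanSpace ℝ (Fin 3)) x = w := by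
    rintro _ rfl x w h
    exact h
  exact ⟨_, key _ h5 _ _ h6⟩

lemma exists_momentum_ne_zero {g : G} {p : TangentSpace (𝓡 3) g →L[ℝ] ℝ} (hp : p ≠ 0) :
    ∃ x : GroupLieAlgebra (𝓡 3) G, momentum p x ≠ 0 := by
  by_contra! h
  refine hp (ContinuousLinearMap.ext fun v => ?_)
  obtain ⟨x, rfl⟩ := exists_mulInvariantVectorField_eq g v
  exact h x

end Momentum

/-- A Pontryagin extremal expressed through the momenta of an adapted basis. -/
structure IsReducedExtremal (Ω : Set (ℝ × ℝ)) (a b T lam : ℝ) (u : ℝ → ℝ × ℝ)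
    (h₁ h₂ h₃ : ℝ → ℝ) : Prop where
  T_pos : 0 < T
  lam_mem : lam = 0 ∨ lam = -1
  nontrivial : ∀ t ∈ Icc 0 T, lam = 0 → h₁ t = 0 → h₂ t = 0 → h₃ t ≠ 0
  lipschitz₁ : ∃ K : NNReal, LipschitzOnWith K h₁ (Icc 0 T)
  lipschitz₂ : ∃ K : NNReal, LipschitzOnWith K h₂ (Icc 0 T)
  lipschitz₃ : ∃ K : NNReal, LipschitzOnWith K h₃ (Icc 0 T)
  deriv₁ : ∀ᵐ t ∂(volume.restrict (Icc 0 T)), HasDerivAt h₁ (-((u t).2 * h₃ t)) t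
  deriv₂ : ∀ᵐ t ∂(volume.restrict (Icc 0 T)), HasDerivAt h₂ ((u t).1 * h₃ t) t
  deriv₃ : ∀ᵐ t ∂(volume.restrict (Icc 0 T)),
    HasDerivAt h₃ (-((u t).1 * (a * h₂ t)) - (u t).2 * (b * h₁ t)) t
  maximum : ∀ᵐ t ∂(volume.restrict (Icc 0 T)), u t ∈ cone Ω ∧ ∀ v ∈ cone Ω,
    pontryagin Ω lam (h₁ t, h₂ t) v ≤ pontryagin Ω lam (h₁ t, h₂ t) (u t)
  ne_zero : ∀ᵐ t ∂(volume.restrict (Icc 0 T)), u t ≠ 0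

lemma IsExtremal.isReducedExtremal {G : Type*} [TopologicalSpace G]
    [ChartedSpace (EuclideanSpace ℝ (Fin 3)) G] [Group G] [LieGroup (𝓡 3) (minSmoothness ℝ 3) G]
    {U : Set (GroupLieAlgebra (𝓡 3) G)} (hdim : Module.finrank ℝ (Submodule.span ℝ U) = 2)
    {a b : ℝ} {f₁ f₂ : GroupLieAlgebra (𝓡 3) G} (hf : IsAdaptedFrame U a b f₁ f₂)
    {Ω : Set (ℝ × ℝ)} {T lam : ℝ} {q : ℝ → G} {p : (t : ℝ) → TangentSpace (𝓡 3) (q t) →L[ℝ] ℝ}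
    {u : ℝ → ℝ × ℝ} (hE : IsExtremal f₁ f₂ Ω T lam q p u)
    (hu : ∀ᵐ t ∂(volume.restrict (Icc 0 T)), u t ≠ 0) :
    IsReducedExtremal Ω a b T lam u (fun t => momentum (p t) f₁) (fun t => momentum (p t) f₂)
      (fun t => momentum (p t) ⁅f₁, f₂⁆) where
  T_pos := hE.T_pos
  lam_mem := hE.lam_mem
  nontrivial t ht hlam h1 h2 h3 := by
    obtain ⟨x, hx⟩ := exists_momentum_ne_zero ((hE.nontrivial t ht).resolve_left (by simp [hlam]))
    have hle : Submodule.span ℝ U ≤ LinearMap.ker (momentumMap (p t)) := by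
      rw [← hf.span_eq, Submodule.span_le]
      rintro _ (rfl | rfl)
      · exact h1
      · exact h2
    -- The kernel of the momentum contains the plane `Δ` and also `[f₁, f₂]` outside it, so it is
    -- the whole three-dimensional algebra.
    have hlt : Submodule.span ℝ U < LinearMap.ker (momentumMap (p t)) :=
      lt_of_le_not_ge hle fun h => hf.f₃_notMem (h h3)
    have : FiniteDimensional ℝ (GroupLieAlgebra (𝓡 3) G) :=
      Module.finite_of_finrank_pos (by rw [finrank_groupLieAlgebra]; norm_num)
    have h4 := Submodule.finrank_lt_finrank_of_lt hlt
    have h5 := Submodule.finrank_le (LinearMap.ker (momentumMap (p t)))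
    rw [finrank_groupLieAlgebra] at h5
    have h6 : LinearMap.ker (momentumMap (p t)) = ⊤ :=
      Submodule.eq_top_of_finrank_eq (by rw [finrank_groupLieAlgebra]; omega)
    exact hx (h6 ▸ Submodule.mem_top : x ∈ LinearMap.ker (momentumMap (p t)))
  lipschitz₁ := hE.p_lipschitz f₁
  lipschitz₂ := hE.p_lipschitz f₂
  lipschitz₃ := hE.p_lipschitz _
  deriv₁ := by
    filter_upwards [hE.p_deriv f₁] with t ht
    convert ht using 1
    rw [add_lie, smul_lie, smul_lie, lie_self, smul_zero, zero_add, ← lie_skew f₂ f₁,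
      momentum_smul, momentum_neg]
    ring
  deriv₂ := by
    filter_upwards [hE.p_deriv f₂] with t ht
    convert ht using 1
    rw [add_lie, smul_lie, smul_lie, lie_self, smul_zero, add_zero, momentum_smul]
  deriv₃ := by
    filter_upwards [hE.p_deriv ⁅f₁, f₂⁆] with t ht
    convert ht using 1
    rw [add_lie, smul_lie, smul_lie, ← lie_skew f₁ ⁅f₁, f₂⁆, ← lie_skew f₂ ⁅f₁, f₂⁆, hf.lie_f₁,
      hf.lie_f₂, momentum_add]
    simp only [momentum_smul, momentum_neg]
    ring
  maximum := hE.maximum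
  ne_zero := hu

/-! ### The maximum condition -/

lemma pontryagin_eq (hΩ : IsBall Ω) (hD : DualAssumptions Ω) (lam x y : ℝ) {v : ℝ × ℝ}
    (hv : v ∈ cone Ω) :
    pontryagin Ω lam (x, y) v = -pairing (-x, y) v - lam * dualGauge Ω v := by
  rw [pontryagin, antiNorm_eq_dualGauge hΩ hD hv, EReal.toReal_coe, pairing]
  ring

lemma pontryagin_smul (hΩ : IsBall Ω) (hD : DualAssumptions Ω) (lam x y : ℝ) {c : ℝ} (hc : 0 ≤ c)
    {v : ℝ × ℝ} (hv : v ∈ cone Ω) :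
    pontryagin Ω lam (x, y) (c • v) = c * pontryagin Ω lam (x, y) v := by
  rw [pontryagin_eq hΩ hD lam x y (smul_mem_cone hc hv), pontryagin_eq hΩ hD lam x y hv,
    pairing_smul_right, dualGauge_smul hc]
  ring

lemma pontryagin_zero (hΩ : IsBall Ω) (hD : DualAssumptions Ω) (lam x y : ℝ) :
    pontryagin Ω lam (x, y) 0 = 0 := by
  have := pontryagin_smul hΩ hD lam x y le_rfl hΩ.zero_mem_cone
  simpa using this

lemma ae_mem_Ioo (a b : ℝ) : ∀ᵐ t ∂(volume.restrict (Icc a b)), t ∈ Ioo a b := by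
  rw [← Measure.restrict_congr_set Ioo_ae_eq_Icc]
  exact ae_restrict_mem measurableSet_Ioo

/-- The sets `Ω` and `Ω^◇` meet every ray at most once along their boundaries. -/
lemma frontier_injOn (hΩ : IsBall Ω) (hD : DualAssumptions Ω) :
    ∀ w ∈ frontier Ω, ∀ z ∈ frontier Ω, cross w z = 0 → w = z :=
  frontier_injOn_rays hΩ fun c hc w hw => hD.star c hc w (hΩ.closed.frontier_subset hw)

lemma frontier_antipolar_injOn (hΩ : IsBall Ω) (hD : DualAssumptions Ω) :
    ∀ w ∈ frontier (antipolar Ω), ∀ z ∈ frontier (antipolar Ω), cross w z = 0 → w = z :=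
  frontier_injOn_rays (antipolar_isBall hΩ) (star_antipolar hΩ hD)

/-- The pairing with a fixed vector, as a linear form. -/
def pairingMap (w : ℝ × ℝ) : (ℝ × ℝ) →ₗ[ℝ] ℝ where
  toFun P := pairing P w
  map_add' P Q := pairing_add_left P Q w
  map_smul' c P := pairing_smul_left P c w

namespace IsReducedExtremal

variable {a b T lam : ℝ} {u : ℝ → ℝ × ℝ} {h₁ h₂ h₃ : ℝ → ℝ}

lemma exists_lipschitz (hE : IsReducedExtremal Ω a b T lam u h₁ h₂ h₃) :
    ∃ K : NNReal, LipschitzOnWith K (fun t => (-h₁ t, h₂ t)) (Icc 0 T) := by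
  obtain ⟨K₁, h1⟩ := hE.lipschitz₁
  obtain ⟨K₂, h2⟩ := hE.lipschitz₂
  exact ⟨_, h1.neg.prodMk h2⟩

lemma continuousOn (hE : IsReducedExtremal Ω a b T lam u h₁ h₂ h₃) :
    ContinuousOn (fun t => (-h₁ t, h₂ t)) (Icc 0 T) := by
  obtain ⟨K, hK⟩ := hE.exists_lipschitz
  exact hK.continuousOn

/-- By homogeneity, comparing the maximizer `u` with `0` shows that the maximum is at least zero,
and comparing it with `2u` shows that it is at most zero. -/
lemma ae_pontryagin_eq_zero (hΩ : IsBall Ω) (hD : DualAssumptions Ω)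
    (hE : IsReducedExtremal Ω a b T lam u h₁ h₂ h₃) :
    ∀ᵐ t ∂(volume.restrict (Icc 0 T)), pontryagin Ω lam (h₁ t, h₂ t) (u t) = 0 := by
  filter_upwards [hE.maximum] with t ⟨hu, hmax⟩
  have h1 := hmax 0 hΩ.zero_mem_cone
  have h2 := hmax ((2 : ℝ) • u t) (smul_mem_cone (by norm_num) hu)
  rw [pontryagin_zero hΩ hD] at h1
  rw [pontryagin_smul hΩ hD _ _ _ (by norm_num) hu] at h2
  linarith

lemma pontryagin_nonpos (hΩ : IsBall Ω) (hD : DualAssumptions Ω)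
    (hE : IsReducedExtremal Ω a b T lam u h₁ h₂ h₃) {t : ℝ} (ht : t ∈ Icc 0 T) {v : ℝ × ℝ}
    (hv : v ∈ cone Ω) : pontryagin Ω lam (h₁ t, h₂ t) v ≤ 0 := by
  have h := forall_mem_of_ae_mem (A := {P | -pairing P v - lam * dualGauge Ω v ≤ 0}) hE.T_pos
    hE.continuousOn (isClosed_le (((continuous_pairing_left v).neg).sub continuous_const)
      continuous_const) (by
      filter_upwards [hE.maximum, hE.ae_pontryagin_eq_zero hΩ hD] with t ⟨_, hmax⟩ h0
      have := hmax v hv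
      rwa [h0, pontryagin_eq hΩ hD _ _ _ hv] at this) t ht
  rw [pontryagin_eq hΩ hD _ _ _ hv]
  exact h

lemma isGreatest_cone (hΩ : IsBall Ω) (hD : DualAssumptions Ω)
    (hE : IsReducedExtremal Ω a b T lam u h₁ h₂ h₃) {t : ℝ} (ht : t ∈ Icc 0 T) :
    IsGreatest (pontryagin Ω lam (h₁ t, h₂ t) '' cone Ω) 0 := by
  refine ⟨⟨0, hΩ.zero_mem_cone, pontryagin_zero hΩ hD _ _ _⟩, ?_⟩
  rintro _ ⟨v, hv, rfl⟩
  exact hE.pontryagin_nonpos hΩ hD ht hv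

/-! ### Abnormal extremals -/

/-- The functional of `(-h₁, h₂)` is nonnegative on the cone and vanishes at `u ≠ 0`, hence on one
of the boundary directions `d₀`, `d₁`. This condition is closed, so it holds at every time. The
points of `Ω` approaching that direction then show that the supremum is zero. -/
lemma isLUB_of_abnormal (hΩ : IsBall Ω) (hD : DualAssumptions Ω)
    (hE : IsReducedExtremal Ω a b T 0 u h₁ h₂ h₃) {t : ℝ} (ht : t ∈ Icc 0 T) :
    IsLUB (pontryagin Ω 0 (h₁ t, h₂ t) '' Ω) 0 := by
  have hle : ∀ t ∈ Icc 0 T, ∀ v ∈ cone Ω, 0 ≤ pairing (-h₁ t, h₂ t) v := fun t ht v hv => by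
    have := hE.pontryagin_nonpos hΩ hD ht hv
    rw [pontryagin_eq hΩ hD _ _ _ hv] at this
    linarith
  obtain ⟨d₀, d₁, h0, h1, hf, hd0, hd1⟩ := hD.starstar
  have hmem : (-h₁ t, h₂ t) ∈
      {P | pairing P d₀ = 0} ∪ {P | pairing P d₁ = 0} := by
    refine forall_mem_of_ae_mem (f := fun t => (-h₁ t, h₂ t)) hE.T_pos hE.continuousOn
      ((isClosed_eq (continuous_pairing_left d₀) continuous_const).union
        (isClosed_eq (continuous_pairing_left d₁) continuous_const)) ?_ t ht
    filter_upwards [hE.maximum, hE.ae_pontryagin_eq_zero hΩ hD, hE.ne_zero,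
      ae_restrict_mem measurableSet_Icc] with s ⟨hu, _⟩ hz hu0 hs
    rw [pontryagin_eq hΩ hD _ _ _ hu, zero_mul, sub_zero, neg_eq_zero] at hz
    have hray : ∀ d, u s ∈ ray d → pairing (-h₁ s, h₂ s) d = 0 := by
      rintro d ⟨c, hc, hcd⟩
      rw [hcd, pairing_smul_right, mul_eq_zero] at hz
      exact hz.resolve_left fun hc0 => hu0 (by rw [hcd, hc0, zero_smul])
    by_cases hi : u s ∈ interior (cone Ω)
    -- A nonnegative functional that vanishes at an interior point vanishes identically; only its
    -- value at `d₀` is needed here.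
    · left
      have ht' : Tendsto (fun c : ℝ => u s - c • d₀) (𝓝 0) (𝓝 (u s)) := by
        have : Continuous fun c : ℝ => u s - c • d₀ := by fun_prop
        simpa using this.tendsto 0
      obtain ⟨c, hc, hc0⟩ := (((ht'.mono_left nhdsWithin_le_nhds).eventually
        (mem_interior_iff_mem_nhds.1 hi)).and (self_mem_nhdsWithin (s := Ioi (0 : ℝ)))).exists
      have h2 := hle s hs _ hc
      rw [sub_eq_add_neg, ← neg_smul, pairing_add_right, hz, pairing_smul_right] at h2
      have hd : d₀ ∈ cone Ω := (isClosed_cone Ω).frontier_subset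
        (hf ▸ Or.inl ⟨1, zero_le_one, (one_smul _ _).symm⟩)
      have h3 := hle s hs _ hd
      have hc0 : (0 : ℝ) < c := hc0
      rw [mem_ofPred_eq]
      nlinarith
    · have hfr : u s ∈ frontier (cone Ω) := ⟨subset_closure hu, hi⟩
      rw [hf] at hfr
      exact hfr.imp (hray d₀) (hray d₁)
  have hlt : ∀ δ : ℝ, 0 < δ → ∃ y ∈ Ω, pairing (-h₁ t, h₂ t) y < δ := fun δ hδ => by
    rcases hmem with h | h
    · exact exists_pairing_lt hd0 (le_of_eq h) hδ
    · exact exists_pairing_lt hd1 (le_of_eq h) hδ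
  refine ⟨?_, fun x hx => ?_⟩
  · rintro _ ⟨v, hv, rfl⟩
    exact hE.pontryagin_nonpos hΩ hD ht (subset_cone hv)
  · by_contra! hneg
    obtain ⟨y, hy, hyx⟩ := hlt (-x) (by linarith)
    have := hx ⟨y, hy, rfl⟩
    rw [pontryagin_eq hΩ hD _ _ _ (subset_cone hy)] at this
    linarith

/-- A control with positive anti-norm is interior to the cone, so the functional vanishes and `h₁ =
h₂ = 0`. Then `h₃ ≠ 0` by nontriviality, while at almost every such time the derivatives `-u₂ h₃`
and `u₁ h₃` vanish, contradicting `u ≠ 0`. -/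
lemma isLightlike_of_abnormal (hΩ : IsBall Ω) (hD : DualAssumptions Ω)
    (hE : IsReducedExtremal Ω a b T 0 u h₁ h₂ h₃) : IsLightlike Ω T u := by
  filter_upwards [hE.maximum, hE.ae_pontryagin_eq_zero hΩ hD, hE.ne_zero,
    ae_restrict_mem measurableSet_Icc, hE.deriv₁, hE.deriv₂,
    ae_restrict_of_ae (ae_hasDerivAt_eq_zero_of_eq h₁ 0),
    ae_restrict_of_ae (ae_hasDerivAt_eq_zero_of_eq h₂ 0)] with t ⟨hu, _⟩ hz hu0 ht hd1 hd2 hz1 hz2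
  rw [antiNorm_eq_dualGauge hΩ hD hu, EReal.coe_eq_zero]
  by_contra hne
  have hpos : 0 < dualGauge Ω (u t) := (dualGauge_nonneg hΩ hu).lt_of_ne' hne
  have hi := mem_interior_cone_of_dualGauge_pos hΩ hD hu hpos
  rw [pontryagin_eq hΩ hD _ _ _ hu, zero_mul, sub_zero, neg_eq_zero] at hz
  have hle : ∀ v ∈ cone Ω, 0 ≤ pairing (-h₁ t, h₂ t) v := fun v hv => by
    have := hE.pontryagin_nonpos hΩ hD ht hv
    rw [pontryagin_eq hΩ hD _ _ _ hv] at this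
    linarith
  have hzero : ∀ d, pairing (-h₁ t, h₂ t) d ≤ 0 := by
    intro d
    have ht' : Tendsto (fun c : ℝ => u t - c • d) (𝓝 0) (𝓝 (u t)) := by
      have : Continuous fun c : ℝ => u t - c • d := by fun_prop
      simpa using this.tendsto 0
    obtain ⟨c, hc, hc0⟩ := (((ht'.mono_left nhdsWithin_le_nhds).eventually
      (mem_interior_iff_mem_nhds.1 hi)).and (self_mem_nhdsWithin (s := Ioi (0 : ℝ)))).exists
    have h2 := hle _ hc
    rw [sub_eq_add_neg, ← neg_smul, pairing_add_right, hz, pairing_smul_right] at h2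
    have hc0 : (0 : ℝ) < c := hc0
    nlinarith
  have e1 := hzero (1, 0)
  have e2 := hzero (-1, 0)
  have e3 := hzero (0, 1)
  have e4 := hzero (0, -1)
  simp only [pairing] at e1 e2 e3 e4
  have hh1 : h₁ t = 0 := by linarith
  have hh2 : h₂ t = 0 := by linarith
  have hh3 := hE.nontrivial t ht rfl hh1 hh2
  have hu2 := hz1 hh1 _ hd1
  have hu1 := hz2 hh2 _ hd2
  rw [neg_eq_zero, mul_eq_zero] at hu2
  rw [mul_eq_zero] at hu1
  exact hu0 (Prod.ext (hu1.resolve_right hh3) (hu2.resolve_right hh3))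

/-! ### Normal extremals -/

lemma mem_antipolar (hΩ : IsBall Ω) (hD : DualAssumptions Ω)
    (hE : IsReducedExtremal Ω a b T (-1) u h₁ h₂ h₃) {t : ℝ} (ht : t ∈ Icc 0 T) :
    (-h₁ t, h₂ t) ∈ antipolar Ω := by
  intro w hw
  have h1 := hE.pontryagin_nonpos hΩ hD ht (subset_cone hw)
  rw [pontryagin_eq hΩ hD _ _ _ (subset_cone hw)] at h1
  have := one_le_dualGauge hΩ hw
  linarith

/-- For a normal extremal the control, rescaled to `∂Ω`, supports `Ω^◇` at `(-h₁, h₂)`. -/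
lemma ae_control (hΩ : IsBall Ω) (hD : DualAssumptions Ω)
    (hE : IsReducedExtremal Ω a b T (-1) u h₁ h₂ h₃) :
    ∀ᵐ t ∂(volume.restrict (Icc 0 T)), u t ∈ cone Ω ∧ 0 < dualGauge Ω (u t) ∧
      (dualGauge Ω (u t))⁻¹ • u t ∈ Ω ∧
      pairing (-h₁ t, h₂ t) ((dualGauge Ω (u t))⁻¹ • u t) = 1 := by
  filter_upwards [hE.maximum, hE.ae_pontryagin_eq_zero hΩ hD, hE.ne_zero,
    ae_restrict_mem measurableSet_Icc] with t ⟨hu, _⟩ hz hu0 ht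
  rw [pontryagin_eq hΩ hD _ _ _ hu] at hz
  -- Strict positivity on all nonzero vectors of the cone, its frontier included, excludes controls
  -- of zero anti-norm.
  have hpos := pairing_pos_of_mem_cone hΩ hD (hE.mem_antipolar hΩ hD ht) hu hu0
  have heq : pairing (-h₁ t, h₂ t) (u t) = dualGauge Ω (u t) := by linarith
  rw [heq] at hpos
  refine ⟨hu, hpos, inv_dualGauge_smul_mem hΩ hu hpos, ?_⟩
  rw [pairing_smul_right, heq, inv_mul_cancel₀ hpos.ne']

lemma isTimelike_of_normal (hΩ : IsBall Ω) (hD : DualAssumptions Ω)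
    (hE : IsReducedExtremal Ω a b T (-1) u h₁ h₂ h₃) : IsTimelike Ω T u := by
  filter_upwards [hE.ae_control hΩ hD] with t ⟨hu, hpos, _⟩
  rw [antiNorm_eq_dualGauge hΩ hD hu]
  exact_mod_cast hpos

lemma mem_frontier (hΩ : IsBall Ω) (hD : DualAssumptions Ω)
    (hE : IsReducedExtremal Ω a b T (-1) u h₁ h₂ h₃) {t : ℝ} (ht : t ∈ Icc 0 T) :
    (-h₁ t, h₂ t) ∈ frontier (antipolar Ω) := by
  refine forall_mem_of_ae_mem (f := fun t => (-h₁ t, h₂ t)) hE.T_pos hE.continuousOn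
    isClosed_frontier ?_ t ht
  filter_upwards [hE.ae_control hΩ hD, ae_restrict_mem measurableSet_Icc] with t ⟨_, _, hw, h1⟩ ht
  exact mem_frontier_antipolar (hE.mem_antipolar hΩ hD ht) hw h1

lemma isGreatest_of_normal (hΩ : IsBall Ω) (hD : DualAssumptions Ω)
    (hE : IsReducedExtremal Ω a b T (-1) u h₁ h₂ h₃) {t : ℝ} (ht : t ∈ Icc 0 T) :
    IsGreatest (pontryagin Ω (-1) (h₁ t, h₂ t) '' Ω) 0 := by
  constructor
  -- At a supporting point `w` the Pontryagin function is `-1 + ν(w) ≥ 0`.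
  · obtain ⟨w, hw, h1⟩ := exists_pairing_eq_one hΩ hD (hE.mem_frontier hΩ hD ht)
    refine ⟨w, hw, le_antisymm (hE.pontryagin_nonpos hΩ hD ht (subset_cone hw)) ?_⟩
    rw [pontryagin_eq hΩ hD _ _ _ (subset_cone hw), h1]
    have := one_le_dualGauge hΩ hw
    linarith
  · rintro _ ⟨v, hv, rfl⟩
    exact hE.pontryagin_nonpos hΩ hD ht (subset_cone hv)

/-- The first integral of the vertical part of the Hamiltonian system. -/
lemma first_integral (hE : IsReducedExtremal Ω a b T lam u h₁ h₂ h₃) {t : ℝ} (ht : t ∈ Icc 0 T) :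
    h₃ t ^ 2 + a * h₂ t ^ 2 - b * h₁ t ^ 2 = h₃ 0 ^ 2 + a * h₂ 0 ^ 2 - b * h₁ 0 ^ 2 := by
  obtain ⟨K₁, hK1⟩ := hE.lipschitz₁
  obtain ⟨K₂, hK2⟩ := hE.lipschitz₂
  obtain ⟨K₃, hK3⟩ := hE.lipschitz₃
  have hu : uIcc 0 T = Icc 0 T := uIcc_of_le hE.T_pos.le
  rw [← hu] at hK1 hK2 hK3
  have a1 := hK1.absolutelyContinuousOnInterval
  have a2 := hK2.absolutelyContinuousOnInterval
  have a3 := hK3.absolutelyContinuousOnInterval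
  have hac : AbsolutelyContinuousOnInterval
      (fun t => h₃ t * h₃ t + a * (h₂ t * h₂ t) - b * (h₁ t * h₁ t)) 0 T :=
    ((a3.mul a3).add ((a2.mul a2).const_mul a)).sub ((a1.mul a1).const_mul b)
  -- The terms cancel whatever the control is; neither the maximum condition nor the value of `lam`
  -- matters.
  have hd : ∀ᵐ t ∂(volume.restrict (Icc 0 T)), HasDerivAt
      (fun t => h₃ t * h₃ t + a * (h₂ t * h₂ t) - b * (h₁ t * h₁ t)) 0 t := by
    filter_upwards [hE.deriv₁, hE.deriv₂, hE.deriv₃] with t d1 d2 d3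
    exact (((d3.mul d3).add ((d2.mul d2).const_mul a)).sub
      ((d1.mul d1).const_mul b)).congr_deriv (by ring)
  have h : h₃ t * h₃ t + a * (h₂ t * h₂ t) - b * (h₁ t * h₁ t) =
      h₃ 0 * h₃ 0 + a * (h₂ 0 * h₂ 0) - b * (h₁ 0 * h₁ 0) :=
    eq_of_ae_hasDerivAt_zero hac hE.T_pos.le hd t ht
  linarith

/-- With `P = (-h₁, h₂)` the speed is `cross P P' = h₃ * pairing P u`, and `pairing P u = 1` when
`ν(u) = 1`. The control itself provides the supporting functional of `Ω^◇` at `P`. Continuity of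
`h₃` extends the formula from almost every time to every interior time. -/
lemma hasDerivAt_angle (hΩ : IsBall Ω) (hD : DualAssumptions Ω)
    (hE : IsReducedExtremal Ω a b T (-1) u h₁ h₂ h₃) {P₀ : ℝ × ℝ}
    (hP₀ : P₀ ∈ frontier (antipolar Ω)) (hnat : IsNatural Ω T u) {t : ℝ} (ht : t ∈ Ioo 0 T) :
    HasDerivAt (fun t => sectorAngle (antipolar Ω) P₀ (-h₁ t, h₂ t)) (h₃ t) t := by
  obtain ⟨L, hL⟩ := hE.exists_lipschitz
  obtain ⟨L', hL'⟩ := lipschitzOnWith_sectorAngle (antipolar_isBall hΩ)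
    (frontier_antipolar_injOn hΩ hD) hP₀ (fun t ht => hE.mem_frontier hΩ hD ht) hL
  obtain ⟨K₃, hK3⟩ := hE.lipschitz₃
  refine hasDerivAt_of_ae_hasDerivAt hL' hK3.continuousOn ?_ ht
  filter_upwards [hE.ae_control hΩ hD, hnat, hE.deriv₁, hE.deriv₂, ae_mem_Ioo 0 T]
    with s ⟨hu, hpos, hw, h1⟩ hn d1 d2 hs
  rw [antiNorm_eq_dualGauge hΩ hD hu] at hn
  have hn1 : dualGauge Ω (u s) = 1 := by exact_mod_cast hn
  rw [hn1, inv_one, one_smul] at hw h1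
  have hd : HasDerivAt (fun t => (-h₁ t, h₂ t)) (-(-((u s).2 * h₃ s)), (u s).1 * h₃ s) s :=
    d1.neg.prodMk d2
  have := hasDerivAt_sectorAngle (antipolar_isBall hΩ) (frontier_antipolar_injOn hΩ hD) hP₀
    (γ := fun t => (-h₁ t, h₂ t)) (by
      filter_upwards [Icc_mem_nhds hs.1 hs.2] with r hr using hE.mem_frontier hΩ hD hr) hd
    (pairingMap (u s)) (fun P hP => hP _ hw) h1
  convert this using 1
  simp only [pairing] at h1
  simp only [cross]
  linear_combination (-h₃ s) * h1

/-- On a singular arc the momenta are constant and `h₃` vanishes. -/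
lemma singular (hΩ : IsBall Ω) (hD : DualAssumptions Ω)
    (hE : IsReducedExtremal Ω a b T (-1) u h₁ h₂ h₃) {F : Set (ℝ × ℝ)} {S : Set ℝ}
    (hS : IsSingularOn Ω T (fun t => (h₁ t, h₂ t)) F S) :
    ∃ c : ℝ × ℝ, ∀ᵐ t ∂(volume.restrict S), t ∈ Icc 0 T ∧ (-h₁ t, h₂ t) = c ∧ h₃ t = 0 := by
  obtain ⟨v, hv, v', hv', hne⟩ := hS.nontrivial
  have hmem : ∀ᵐ t ∂(volume.restrict S), t ∈ Icc 0 T :=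
    ae_restrict_of_ae_restrict_of_subset hS.subset (ae_restrict_mem measurableSet_Icc)
  have hone : ∀ᵐ t ∂(volume.restrict S), v ∈ Ω ∧ v' ∈ Ω ∧ t ∈ Icc 0 T ∧
      pairing (-h₁ t, h₂ t) v = 1 ∧ pairing (-h₁ t, h₂ t) v' = 1 := by
    filter_upwards [hmem, hS.argmax] with t ht harg
    obtain ⟨w, hw, h1⟩ := exists_pairing_eq_one hΩ hD (hE.mem_frontier hΩ hD ht)
    -- Maximizing `⟨h, ·⟩` means minimizing the pairing with `(-h₁, h₂)`, whose minimum over `Ω` is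
    -- `1`.
    have hall : ∀ x ∈ F, x ∈ Ω ∧ pairing (-h₁ t, h₂ t) x = 1 := by
      intro x hx
      rw [← harg] at hx
      have h2 := hx.2 w hw
      have h3 := hE.mem_antipolar hΩ hD ht x hx.1
      refine ⟨hx.1, le_antisymm ?_ h3⟩
      simp only [pairing] at h1 h3 ⊢
      linarith
    exact ⟨(hall v hv).1, (hall v' hv').1, ht, (hall v hv).2, (hall v' hv').2⟩
  have hne0 : (ae (volume.restrict S)).NeBot :=
    ae_neBot.2 fun h => hS.pos.ne' (Measure.restrict_eq_zero.1 h)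
  obtain ⟨t₀, hvΩ, hvΩ', ht₀, e1, e2⟩ := hone.exists
  have hanti := hE.mem_antipolar hΩ hD ht₀
  -- Two distinct frontier points of `Ω` are linearly independent, so the equations `pairing P v =
  -- 1` and `pairing P v' = 1` determine `P`.
  have hcross : cross v v' ≠ 0 := fun h => hne (frontier_injOn hΩ hD v
    (mem_frontier_of_pairing hanti hvΩ e1) v' (mem_frontier_of_pairing hanti hvΩ' e2) h)
  have hconst : ∀ᵐ t ∂(volume.restrict S), h₁ t = h₁ t₀ ∧ h₂ t = h₂ t₀ := by
    filter_upwards [hone] with t ⟨_, _, _, e3, e4⟩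
    simp only [pairing, cross] at e1 e2 e3 e4 hcross
    constructor
    · refine sub_eq_zero.1 ((mul_eq_zero.1 ?_).resolve_right hcross)
      linear_combination v'.2 * (e1 - e3) - v.2 * (e2 - e4)
    · refine sub_eq_zero.1 ((mul_eq_zero.1 ?_).resolve_right hcross)
      linear_combination v.1 * (e2 - e4) - v'.1 * (e1 - e3)
  refine ⟨(-h₁ t₀, h₂ t₀), ?_⟩
  filter_upwards [hmem, hconst,
    ae_restrict_of_ae_restrict_of_subset hS.subset hE.deriv₁,
    ae_restrict_of_ae_restrict_of_subset hS.subset hE.deriv₂,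
    ae_restrict_of_ae_restrict_of_subset hS.subset hE.ne_zero,
    ae_restrict_of_ae (ae_hasDerivAt_eq_zero_of_eq h₁ (h₁ t₀)),
    ae_restrict_of_ae (ae_hasDerivAt_eq_zero_of_eq h₂ (h₂ t₀))]
    with t ht ⟨c1, c2⟩ d1 d2 hu0 z1 z2
  refine ⟨ht, by rw [c1, c2], ?_⟩
  -- On a level set of `h₁` and `h₂` both derivatives vanish almost everywhere, so `u ≠ 0` forces
  -- `h₃ = 0`.
  have hu2 := z1 c1 _ d1
  have hu1 := z2 c2 _ d2
  rw [neg_eq_zero, mul_eq_zero] at hu2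
  rw [mul_eq_zero] at hu1
  by_contra h3
  exact hu0 (Prod.ext (hu1.resolve_right h3) (hu2.resolve_right h3))

end IsReducedExtremal

/-- A continuous function without zeros on an interval has constant sign. -/
lemma exists_sign_of_ne_zero {f : ℝ → ℝ} {α β : ℝ} (hαβ : α < β) (hf : ContinuousOn f (Ioo α β))
    (h0 : ∀ t ∈ Ioo α β, f t ≠ 0) :
    ∃ σ : ℝ, (σ = 1 ∨ σ = -1) ∧ ∀ t ∈ Ioo α β, 0 < σ * f t := by
  obtain ⟨m, hm⟩ := nonempty_Ioo.2 hαβ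
  have hno : ∀ s ∈ Ioo α β, ∀ t ∈ Ioo α β, f s < 0 → ¬0 < f t := fun s hs t ht h1 h2 => by
    obtain ⟨r, hr, hr0⟩ := isPreconnected_Ioo.intermediate_value hs ht hf ⟨h1.le, h2.le⟩
    exact h0 r hr hr0
  rcases (h0 m hm).lt_or_gt with h | h
  · refine ⟨-1, Or.inr rfl, fun t ht => ?_⟩
    have := (h0 t ht).lt_or_gt.resolve_right (hno m hm t ht h)
    linarith
  · refine ⟨1, Or.inl rfl, fun t ht => ?_⟩
    have := (h0 t ht).lt_or_gt.resolve_left fun h' => hno t ht m hm h' h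
    linarith

/-! ### Assembly of the conclusions for lightlike and timelike extremals. -/

namespace IsReducedExtremal

variable {a b T lam : ℝ} {u : ℝ → ℝ × ℝ} {h₁ h₂ h₃ : ℝ → ℝ}

lemma neBot_ae_restrict (hE : IsReducedExtremal Ω a b T lam u h₁ h₂ h₃) :
    (ae (volume.restrict (Icc 0 T))).NeBot :=
  ae_neBot.2 fun h => by
    rw [Measure.restrict_eq_zero, Real.volume_Icc, sub_zero, ENNReal.ofReal_eq_zero] at h
    exact h.not_gt hE.T_pos

lemma not_isTimelike_and_isLightlike (hE : IsReducedExtremal Ω a b T lam u h₁ h₂ h₃)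
    (ht : IsTimelike Ω T u) (hl : IsLightlike Ω T u) : False := by
  have := hE.neBot_ae_restrict
  obtain ⟨t, h1, h2⟩ := (ht.and hl).exists
  exact h1.ne' h2

lemma isLightlike_control (hΩ : IsBall Ω) (hD : DualAssumptions Ω)
    (hE : IsReducedExtremal Ω a b T lam u h₁ h₂ h₃) (hl : IsLightlike Ω T u) :
    ∀ᵐ t ∂(volume.restrict (Icc 0 T)), u t ∈ frontier (cone Ω) := by
  filter_upwards [hl, hE.maximum] with t ht ⟨hu, _⟩
  rw [antiNorm_eq_dualGauge hΩ hD hu, EReal.coe_eq_zero] at ht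
  exact ⟨subset_closure hu, fun hi => (dualGauge_pos_of_mem_interior hΩ hD hi).ne' ht⟩

/-- The angle of `Ω^◇` along a normal extremal recovers `h₁` and `h₂`. -/
lemma trigPoint_angle (hΩ : IsBall Ω) (hD : DualAssumptions Ω)
    (hE : IsReducedExtremal Ω a b T (-1) u h₁ h₂ h₃) {P₀ : ℝ × ℝ}
    (hP₀ : P₀ ∈ frontier (antipolar Ω)) {t : ℝ} (ht : t ∈ Icc 0 T) :
    trigPoint (antipolar Ω) P₀ (sectorAngle (antipolar Ω) P₀ (-h₁ t, h₂ t)) = (-h₁ t, h₂ t) :=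
  trigPoint_sectorAngle (antipolar_isBall hΩ) (frontier_antipolar_injOn hΩ hD) hP₀
    (hE.mem_frontier hΩ hD ht)

lemma radicand_angle (hΩ : IsBall Ω) (hD : DualAssumptions Ω)
    (hE : IsReducedExtremal Ω a b T (-1) u h₁ h₂ h₃) {P₀ : ℝ × ℝ}
    (hP₀ : P₀ ∈ frontier (antipolar Ω)) {t : ℝ} (ht : t ∈ Icc 0 T) :
    radicand Ω P₀ a b (h₃ 0 ^ 2 + a * h₂ 0 ^ 2 - b * h₁ 0 ^ 2)
      (sectorAngle (antipolar Ω) P₀ (-h₁ t, h₂ t)) = h₃ t ^ 2 := by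
  rw [radicand, sh, ch, hE.trigPoint_angle hΩ hD hP₀ ht, ← hE.first_integral ht]
  ring

lemma trigPoint_control (hΩ : IsBall Ω) (hD : DualAssumptions Ω)
    (hE : IsReducedExtremal Ω a b T (-1) u h₁ h₂ h₃) {w₀ : ℝ × ℝ} (hw₀ : w₀ ∈ frontier Ω) :
    ∀ᵐ t ∂(volume.restrict (Icc 0 T)),
      (dualGauge Ω (u t))⁻¹ • u t ∈ frontier Ω ∧
      trigPoint Ω w₀ (sectorAngle Ω w₀ ((dualGauge Ω (u t))⁻¹ • u t)) =
        (dualGauge Ω (u t))⁻¹ • u t ∧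
      u t = (antiNorm Ω (u t)).toReal • ((dualGauge Ω (u t))⁻¹ • u t) := by
  filter_upwards [hE.ae_control hΩ hD, ae_restrict_mem measurableSet_Icc] with t ⟨hu, hpos, hw, h1⟩ ht
  have hfr := mem_frontier_of_pairing (hE.mem_antipolar hΩ hD ht) hw h1
  refine ⟨hfr, trigPoint_sectorAngle hΩ (frontier_injOn hΩ hD) hw₀ hfr, ?_⟩
  rw [antiNorm_eq_dualGauge hΩ hD hu, EReal.toReal_coe, smul_smul, mul_inv_cancel₀ hpos.ne',
    one_smul]

lemma timelike_formulas (hΩ : IsBall Ω) (hD : DualAssumptions Ω)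
    (hE : IsReducedExtremal Ω a b T (-1) u h₁ h₂ h₃) {w₀ P₀ : ℝ × ℝ} (hw₀ : w₀ ∈ frontier Ω)
    (hP₀ : P₀ ∈ frontier (antipolar Ω)) :
    ∃ (E : ℝ) (η θ : ℝ → ℝ),
      (∀ t ∈ Icc 0 T, η t ∈ angleDomain (antipolar Ω) P₀ ∧
        h₁ t = -ch (antipolar Ω) P₀ (η t) ∧
        h₂ t = sh (antipolar Ω) P₀ (η t) ∧
        (h₃ t = √(radicand Ω P₀ a b E (η t)) ∨
          h₃ t = -√(radicand Ω P₀ a b E (η t))) ∧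
        a * sh (antipolar Ω) P₀ (η t) ^ 2 -
          b * ch (antipolar Ω) P₀ (η t) ^ 2 ≤ E) ∧
      (∀ᵐ t ∂(volume.restrict (Icc 0 T)), θ t ∈ dualAngles Ω w₀ P₀ (η t) ∧
        u t = (antiNorm Ω (u t)).toReal •
          (ch Ω w₀ (θ t), sh Ω w₀ (θ t))) ∧
      (IsNatural Ω T u →
        (∀ᵐ t ∂(volume.restrict (Icc 0 T)),
          u t = (ch Ω w₀ (θ t), sh Ω w₀ (θ t))) ∧
        ∀ α β : ℝ, 0 ≤ α → α < β → β ≤ T →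
          (∀ t ∈ Ioo α β, a * sh (antipolar Ω) P₀ (η t) ^ 2 -
            b * ch (antipolar Ω) P₀ (η t) ^ 2 < E) →
          ∃ σ : ℝ, (σ = 1 ∨ σ = -1) ∧
            (∀ t ∈ Ioo α β, h₃ t = σ * √(radicand Ω P₀ a b E (η t))) ∧
            ∀ t₁ ∈ Ioo α β, ∀ t₂ ∈ Ioo α β,
              IntervalIntegrable (fun s => 1 / √(radicand Ω P₀ a b E s)) volume
                (η t₁) (η t₂) ∧
              t₂ - t₁ = σ * ∫ s in (η t₁)..(η t₂), 1 / √(radicand Ω P₀ a b E s)) ∧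
      (∀ (F : Set (ℝ × ℝ)) (S : Set ℝ),
        IsSingularOn Ω T (fun t => (h₁ t, h₂ t)) F S →
        ∃ η₀ : ℝ, ∀ᵐ t ∂(volume.restrict S), η t = η₀ ∧
          E = a * sh (antipolar Ω) P₀ (η t) ^ 2 -
            b * ch (antipolar Ω) P₀ (η t) ^ 2) := by
  -- `E` is the value of the first integral. Along the angle `η` of `(-h₁, h₂)` the radicand then
  -- equals `h₃²`, so the inequality for `E` is strict exactly where `h₃ ≠ 0`.
  set E := h₃ 0 ^ 2 + a * h₂ 0 ^ 2 - b * h₁ 0 ^ 2 with hEdef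
  set η : ℝ → ℝ := fun t => sectorAngle (antipolar Ω) P₀ (-h₁ t, h₂ t) with hη
  have hch : ∀ t ∈ Icc 0 T, ch (antipolar Ω) P₀ (η t) = -h₁ t := fun t ht => by
    rw [ch, hE.trigPoint_angle hΩ hD hP₀ ht]
  have hsh : ∀ t ∈ Icc 0 T, sh (antipolar Ω) P₀ (η t) = h₂ t := fun t ht => by
    rw [sh, hE.trigPoint_angle hΩ hD hP₀ ht]
  have hrad : ∀ t ∈ Icc 0 T, radicand Ω P₀ a b E (η t) = h₃ t ^ 2 := fun t ht =>
    hE.radicand_angle hΩ hD hP₀ ht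
  have hEle : ∀ t ∈ Icc 0 T, E - (a * sh (antipolar Ω) P₀ (η t) ^ 2 -
      b * ch (antipolar Ω) P₀ (η t) ^ 2) = h₃ t ^ 2 := fun t ht => by
    rw [← hrad t ht, radicand]; ring
  refine ⟨E, η, fun t => sectorAngle Ω w₀ ((dualGauge Ω (u t))⁻¹ • u t), fun t ht => ?_, ?_, ?_, ?_⟩
  · refine ⟨⟨_, hE.mem_frontier hΩ hD ht, rfl⟩, by rw [hch t ht, neg_neg], (hsh t ht).symm, ?_, ?_⟩
    · rw [hrad t ht, Real.sqrt_sq_eq_abs]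
      rcases abs_choice (h₃ t) with h | h <;> simp [h]
    · have := hEle t ht
      have := sq_nonneg (h₃ t)
      linarith
  · filter_upwards [hE.trigPoint_control hΩ hD hw₀, hE.ae_control hΩ hD,
      ae_restrict_mem measurableSet_Icc] with t ⟨hfr, htp, hut⟩ ⟨_, _, _, h1⟩ ht
    refine ⟨⟨⟨_, hfr, rfl⟩, ?_⟩, ?_⟩
    · rw [htp, hE.trigPoint_angle hΩ hD hP₀ ht, h1]
    · rw [ch, sh, htp]
      exact hut
  · intro hnat
    refine ⟨?_, fun α β hα hαβ hβ hlt => ?_⟩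
    · filter_upwards [hE.trigPoint_control hΩ hD hw₀, hnat] with t ⟨_, htp, hut⟩ hn
      rw [hn, EReal.toReal_one, one_smul] at hut
      rw [ch, sh, htp]
      exact hut
    · have hsub : Ioo α β ⊆ Ioo 0 T := Ioo_subset_Ioo hα hβ
      have hsub' : Ioo α β ⊆ Icc 0 T := hsub.trans Ioo_subset_Icc_self
      obtain ⟨K₃, hK3⟩ := hE.lipschitz₃
      obtain ⟨σ, hσ, hpos⟩ := exists_sign_of_ne_zero hαβ (hK3.continuousOn.mono hsub')
        fun t ht h0 => by
          have h1 := hEle t (hsub' ht)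
          have h2 := hlt t ht
          rw [h0] at h1
          linarith
      have hsqrt : ∀ t ∈ Ioo α β, √(radicand Ω P₀ a b E (η t)) = σ * h₃ t := fun t ht => by
        have h := hpos t ht
        rw [hrad t (hsub' ht), ← Real.sqrt_sq h.le]
        congr 1
        rcases hσ with rfl | rfl <;> ring
      refine ⟨σ, hσ, fun t ht => ?_, fun t₁ ht₁ t₂ ht₂ => ?_⟩
      · rw [hsqrt t ht]
        rcases hσ with rfl | rfl <;> ring
      · exact sub_eq_integral_of_hasDerivAt hσ
          (fun t ht => hE.hasDerivAt_angle hΩ hD hP₀ hnat (hsub ht)) hpos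
          (fun t ht => by rw [hsqrt t ht]) ht₁ ht₂
  · intro F S hS
    obtain ⟨c, hc⟩ := hE.singular hΩ hD hS
    refine ⟨sectorAngle (antipolar Ω) P₀ c, ?_⟩
    filter_upwards [hc] with t ⟨ht, hct, h0⟩
    refine ⟨by rw [hη, ← hct], ?_⟩
    have := hEle t ht
    rw [h0] at this
    linarith

/-- The conclusions on extremals, in terms of the momenta. -/
lemma extremal_classification (hΩ : IsBall Ω) (hD : DualAssumptions Ω)
    (hE : IsReducedExtremal Ω a b T lam u h₁ h₂ h₃) {w₀ P₀ : ℝ × ℝ} (hw₀ : w₀ ∈ frontier Ω)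
    (hP₀ : P₀ ∈ frontier (antipolar Ω)) :
    ((lam = -1 ∧ IsTimelike Ω T u) ∨ (lam = 0 ∧ IsLightlike Ω T u)) ∧
    (∀ t ∈ Icc 0 T,
      IsGreatest (pontryagin Ω lam (h₁ t, h₂ t) '' cone Ω) 0 ∧
      IsLUB (pontryagin Ω lam (h₁ t, h₂ t) '' Ω) 0 ∧
      (lam = -1 → IsGreatest (pontryagin Ω lam (h₁ t, h₂ t) '' Ω) 0)) ∧
    (IsLightlike Ω T u →
      ∀ᵐ t ∂(volume.restrict (Icc 0 T)), u t ∈ frontier (cone Ω)) ∧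
    (IsTimelike Ω T u → ∃ (E : ℝ) (η θ : ℝ → ℝ),
      (∀ t ∈ Icc 0 T, η t ∈ angleDomain (antipolar Ω) P₀ ∧
        h₁ t = -ch (antipolar Ω) P₀ (η t) ∧
        h₂ t = sh (antipolar Ω) P₀ (η t) ∧
        (h₃ t = √(radicand Ω P₀ a b E (η t)) ∨
          h₃ t = -√(radicand Ω P₀ a b E (η t))) ∧
        a * sh (antipolar Ω) P₀ (η t) ^ 2 -
          b * ch (antipolar Ω) P₀ (η t) ^ 2 ≤ E) ∧
      (∀ᵐ t ∂(volume.restrict (Icc 0 T)), θ t ∈ dualAngles Ω w₀ P₀ (η t) ∧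
        u t = (antiNorm Ω (u t)).toReal •
          (ch Ω w₀ (θ t), sh Ω w₀ (θ t))) ∧
      (IsNatural Ω T u →
        (∀ᵐ t ∂(volume.restrict (Icc 0 T)),
          u t = (ch Ω w₀ (θ t), sh Ω w₀ (θ t))) ∧
        ∀ α β : ℝ, 0 ≤ α → α < β → β ≤ T →
          (∀ t ∈ Ioo α β, a * sh (antipolar Ω) P₀ (η t) ^ 2 -
            b * ch (antipolar Ω) P₀ (η t) ^ 2 < E) →
          ∃ σ : ℝ, (σ = 1 ∨ σ = -1) ∧
            (∀ t ∈ Ioo α β, h₃ t = σ * √(radicand Ω P₀ a b E (η t))) ∧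
            ∀ t₁ ∈ Ioo α β, ∀ t₂ ∈ Ioo α β,
              IntervalIntegrable (fun s => 1 / √(radicand Ω P₀ a b E s)) volume
                (η t₁) (η t₂) ∧
              t₂ - t₁ = σ * ∫ s in (η t₁)..(η t₂), 1 / √(radicand Ω P₀ a b E s)) ∧
      (∀ (F : Set (ℝ × ℝ)) (S : Set ℝ),
        IsSingularOn Ω T (fun t => (h₁ t, h₂ t)) F S →
        ∃ η₀ : ℝ, ∀ᵐ t ∂(volume.restrict S), η t = η₀ ∧
          E = a * sh (antipolar Ω) P₀ (η t) ^ 2 -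
            b * ch (antipolar Ω) P₀ (η t) ^ 2)) := by
  rcases hE.lam_mem with rfl | rfl
  · have hl := hE.isLightlike_of_abnormal hΩ hD
    exact ⟨Or.inr ⟨rfl, hl⟩, fun t ht => ⟨hE.isGreatest_cone hΩ hD ht,
      hE.isLUB_of_abnormal hΩ hD ht, fun h => by norm_num at h⟩,
      hE.isLightlike_control hΩ hD,
      fun ht => (hE.not_isTimelike_and_isLightlike ht hl).elim⟩
  · exact ⟨Or.inl ⟨rfl, hE.isTimelike_of_normal hΩ hD⟩, fun t ht =>
      ⟨hE.isGreatest_cone hΩ hD ht, (hE.isGreatest_of_normal hΩ hD ht).isLUB,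
        fun _ => hE.isGreatest_of_normal hΩ hD ht⟩,
      hE.isLightlike_control hΩ hD, fun _ => hE.timelike_formulas hΩ hD hw₀ hP₀⟩

end IsReducedExtremal

/-! ### Passage from the Lie group to the plane. -/

lemma exists_isAdaptedFrame {G : Type*} [TopologicalSpace G]
    [ChartedSpace (EuclideanSpace ℝ (Fin 3)) G] [Group G] [LieGroup (𝓡 3) (minSmoothness ℝ 3) G]
    (hunimodular : ∀ x : GroupLieAlgebra (𝓡 3) G,
      LinearMap.trace ℝ (GroupLieAlgebra (𝓡 3) G)
        (LieAlgebra.ad ℝ (GroupLieAlgebra (𝓡 3) G) x) = 0)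
    (U : Set (GroupLieAlgebra (𝓡 3) G)) (hdim : Module.finrank ℝ (Submodule.span ℝ U) = 2)
    (hgen : ∃ x ∈ Submodule.span ℝ U, ∃ y ∈ Submodule.span ℝ U, ⁅x, y⁆ ∉ Submodule.span ℝ U) :
    ∃ (a b : ℝ) (f₁ f₂ : GroupLieAlgebra (𝓡 3) G), IsAdaptedFrame U a b f₁ f₂ := by
  have : FiniteDimensional ℝ (GroupLieAlgebra (𝓡 3) G) :=
    Module.finite_of_finrank_pos (by rw [finrank_groupLieAlgebra]; norm_num)
  obtain ⟨a, b, f₁, f₂, h1, h2, h3, h4, h5, h6, h7⟩ :=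
    exists_adapted_basis (L := GroupLieAlgebra (𝓡 3) G) finrank_groupLieAlgebra hunimodular
      (Submodule.span ℝ U) hdim hgen
  exact ⟨a, b, f₁, f₂, h1, h2, h3, h4, h5, h6, h7⟩

/-- The unit ball in the coordinates of an adapted basis. -/
lemma IsBall.planeBall_isBall {G : Type*} [TopologicalSpace G]
    [ChartedSpace (EuclideanSpace ℝ (Fin 3)) G] [Group G]
    {U : Set (GroupLieAlgebra (𝓡 3) G)} (hU : IsBall U) {a b : ℝ}
    {f₁ f₂ : GroupLieAlgebra (𝓡 3) G} (hf : IsAdaptedFrame U a b f₁ f₂) :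
    IsBall (planeBall U f₁ f₂) where
  nonempty := by
    obtain ⟨x, hx⟩ := hU.nonempty
    have hxs : x ∈ Submodule.span ℝ {f₁, f₂} := hf.span_eq ▸ Submodule.subset_span hx
    obtain ⟨c, d, rfl⟩ := Submodule.mem_span_pair.1 hxs
    exact ⟨(c, d), hx⟩
  convex := by
    intro v hv w hw s r hs hr hsr
    have := hU.convex hv hw hs hr hsr
    change _ ∈ U
    convert this using 1
    simp only [Prod.fst_add, Prod.snd_add, Prod.smul_fst, Prod.smul_snd, smul_eq_mul]
    module
  closed := by
    refine hU.closed.preimage ?_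
    fun_prop
  zero_notMem h := hU.zero_notMem (by simpa [planeBall] using h)
  ray c hc w hw := by
    have := hU.ray c hc _ hw
    change _ ∈ U
    convert this using 1
    simp only [Prod.smul_fst, Prod.smul_snd, smul_eq_mul]
    module

end SubLorentz

theorem theorem8 {G : Type*} [TopologicalSpace G] [ChartedSpace (EuclideanSpace ℝ (Fin 3)) G]
    [Group G] [LieGroup (𝓡 3) (minSmoothness ℝ 3) G]
    (hunimodular : ∀ x : GroupLieAlgebra (𝓡 3) G,
      LinearMap.trace ℝ (GroupLieAlgebra (𝓡 3) G)
        (LieAlgebra.ad ℝ (GroupLieAlgebra (𝓡 3) G) x) = 0)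
    (U : Set (GroupLieAlgebra (𝓡 3) G)) (hU : SubLorentz.IsBall U)
    (hdim : Module.finrank ℝ (Submodule.span ℝ U) = 2)
    (hgen : ∃ x ∈ Submodule.span ℝ U, ∃ y ∈ Submodule.span ℝ U, ⁅x, y⁆ ∉ Submodule.span ℝ U) :
    (∃ (a b : ℝ) (f₁ f₂ : GroupLieAlgebra (𝓡 3) G), SubLorentz.IsAdaptedFrame U a b f₁ f₂) ∧
    ∀ (a b : ℝ) (f₁ f₂ : GroupLieAlgebra (𝓡 3) G), SubLorentz.IsAdaptedFrame U a b f₁ f₂ →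
    ∀ Ω : Set (ℝ × ℝ), Ω = SubLorentz.planeBall U f₁ f₂ → SubLorentz.DualAssumptions Ω →
    ∀ w₀ ∈ frontier Ω, ∀ P₀ ∈ frontier (SubLorentz.antipolar Ω), SubLorentz.pairing P₀ w₀ = 1 →
    ∀ (T lam : ℝ) (q : ℝ → G) (p : (t : ℝ) → TangentSpace (𝓡 3) (q t) →L[ℝ] ℝ)
      (u : ℝ → ℝ × ℝ) (h₁ h₂ h₃ : ℝ → ℝ),
    SubLorentz.IsExtremal f₁ f₂ Ω T lam q p u →
    (∀ᵐ t ∂(volume.restrict (Icc 0 T)), u t ≠ 0) →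
    (∀ t, h₁ t = SubLorentz.momentum (p t) f₁) →
    (∀ t, h₂ t = SubLorentz.momentum (p t) f₂) →
    (∀ t, h₃ t = SubLorentz.momentum (p t) ⁅f₁, f₂⁆) →
    -- the dichotomy
    ((lam = -1 ∧ SubLorentz.IsTimelike Ω T u) ∨ (lam = 0 ∧ SubLorentz.IsLightlike Ω T u)) ∧
    -- the maximized Hamiltonian vanishes
    (∀ t ∈ Icc 0 T,
      IsGreatest (SubLorentz.pontryagin Ω lam (h₁ t, h₂ t) '' SubLorentz.cone Ω) 0 ∧
      IsLUB (SubLorentz.pontryagin Ω lam (h₁ t, h₂ t) '' Ω) 0 ∧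
      (lam = -1 → IsGreatest (SubLorentz.pontryagin Ω lam (h₁ t, h₂ t) '' Ω) 0)) ∧
    -- lightlike extremals
    (SubLorentz.IsLightlike Ω T u →
      ∀ᵐ t ∂(volume.restrict (Icc 0 T)), u t ∈ frontier (SubLorentz.cone Ω)) ∧
    -- timelike extremals
    (SubLorentz.IsTimelike Ω T u → ∃ (E : ℝ) (η θ : ℝ → ℝ),
      (∀ t ∈ Icc 0 T, η t ∈ SubLorentz.angleDomain (SubLorentz.antipolar Ω) P₀ ∧
        h₁ t = -SubLorentz.ch (SubLorentz.antipolar Ω) P₀ (η t) ∧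
        h₂ t = SubLorentz.sh (SubLorentz.antipolar Ω) P₀ (η t) ∧
        (h₃ t = √(SubLorentz.radicand Ω P₀ a b E (η t)) ∨
          h₃ t = -√(SubLorentz.radicand Ω P₀ a b E (η t))) ∧
        a * SubLorentz.sh (SubLorentz.antipolar Ω) P₀ (η t) ^ 2 -
          b * SubLorentz.ch (SubLorentz.antipolar Ω) P₀ (η t) ^ 2 ≤ E) ∧
      (∀ᵐ t ∂(volume.restrict (Icc 0 T)), θ t ∈ SubLorentz.dualAngles Ω w₀ P₀ (η t) ∧
        u t = (SubLorentz.antiNorm Ω (u t)).toReal •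
          (SubLorentz.ch Ω w₀ (θ t), SubLorentz.sh Ω w₀ (θ t))) ∧
      (SubLorentz.IsNatural Ω T u →
        (∀ᵐ t ∂(volume.restrict (Icc 0 T)),
          u t = (SubLorentz.ch Ω w₀ (θ t), SubLorentz.sh Ω w₀ (θ t))) ∧
        ∀ α β : ℝ, 0 ≤ α → α < β → β ≤ T →
          (∀ t ∈ Ioo α β, a * SubLorentz.sh (SubLorentz.antipolar Ω) P₀ (η t) ^ 2 -
            b * SubLorentz.ch (SubLorentz.antipolar Ω) P₀ (η t) ^ 2 < E) →
          ∃ σ : ℝ, (σ = 1 ∨ σ = -1) ∧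
            (∀ t ∈ Ioo α β, h₃ t = σ * √(SubLorentz.radicand Ω P₀ a b E (η t))) ∧
            ∀ t₁ ∈ Ioo α β, ∀ t₂ ∈ Ioo α β,
              IntervalIntegrable (fun s => 1 / √(SubLorentz.radicand Ω P₀ a b E s)) volume
                (η t₁) (η t₂) ∧
              t₂ - t₁ = σ * ∫ s in (η t₁)..(η t₂), 1 / √(SubLorentz.radicand Ω P₀ a b E s)) ∧
      -- singular arcs
      (∀ (F : Set (ℝ × ℝ)) (S : Set ℝ),
        SubLorentz.IsSingularOn Ω T (fun t => (h₁ t, h₂ t)) F S →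
        ∃ η₀ : ℝ, ∀ᵐ t ∂(volume.restrict S), η t = η₀ ∧
          E = a * SubLorentz.sh (SubLorentz.antipolar Ω) P₀ (η t) ^ 2 -
            b * SubLorentz.ch (SubLorentz.antipolar Ω) P₀ (η t) ^ 2)) := by
  refine ⟨SubLorentz.exists_isAdaptedFrame hunimodular U hdim hgen, ?_⟩
  intro a b f₁ f₂ hf Ω hΩU hD w₀ hw₀ P₀ hP₀ _ T lam q p u h₁ h₂ h₃ hext hu0 hh₁ hh₂ hh₃
  have hΩ : SubLorentz.IsBall Ω := by
    subst hΩU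
    exact hU.planeBall_isBall hf
  have hE := hext.isReducedExtremal hdim hf hu0
  rw [← funext hh₁, ← funext hh₂, ← funext hh₃] at hE
  exact hE.extremal_classification hΩ hD hw₀ hP₀
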